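/- For an (unweighted, simple) graph $H$ on a finite vertex set $V$, let $\phi(H)=\min\{\,e_H(S,V\setminus S)/|S| : S\subset V,\ 0<|S|\le |V|/2\,\}$, where $e_H(S,V\setminus S)$ is the number of edges of $H$ with exactly one endpoint in $S$. Call $H$ an edge-expander if $\phi(H)>\tfrac13$. For a graph $G$ on a vertex set $V$ of even size, call $H$ a $d$-round cut-matching outcome in $G$ if there are bisections $(S_i,V\setminus S_i)$, $|S_i|=|V|/2$, and perfect matchings $M_i\subseteq E(G)$, $i=1,\dots,d$, such that every edge of $M_i$ crosses $(S_i,V\setminus S_i)$, the $M_i$ are pairwise disjoint, and $E(H)=M_1\cup\dots\cup M_d$. (i) There is an absolute constant $C$ such that for every $\delta>0$ there is $n_0(\delta)$ with the following property. For every even $n\ge n_0(\delta)$, every $n$-vertex graph $G$ with minimum degree at least $(\tfrac34+\delta)n$ contains a $d$-regular subgraph $H$ on the vertex set of $G$, for some $d\le C\log n$, which is an edge-expander and a $d$-round cut-matching outcome in $G$. (ii) There are a randomized algorithm $A$, a polynomial $p$ and an absolute constant $C$ such that on every $n$-vertex graph, given by its adjacency matrix, and for every outcome of its at most $p(n)$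 random bits, $A$ halts within $p(n)$ steps, and such that for every $\delta>0$ there is $n_0(\delta)$ with the following property. For every even $n\ge n_0(\delta)$ and every $n$-vertex graph $G$ with minimum degree at least $(\tfrac34+\delta)n$, with probability at least $1-\tfrac1n$ over its random bits $A$ outputs on input $G$ a $d'$-regular subgraph $H'$ of $G$ on the vertex set of $G$, for some $d'\le C\log^2 n$, which is an edge-expander and a $d'$-round cut-matching outcome in $G$. -/

import Mathlib

namespace SparseExpander

/-! ### Edge-expansion and the cut-matching game -/

section Graphs

variable {V : Type*} [Fintype V]

open Classical in
/-- The edge-expansion (Cheeger constant) of an unweighted graph: the minimum of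
`e(S, Sᶜ) / |S|` over the vertex sets `S` with `0 < |S| ≤ |V| / 2`.
(Since `S` and `Sᶜ` are disjoint, `interedges S Sᶜ` counts each crossing edge once. For
`|V| ≥ 2` the set is finite and nonempty, so the infimum is a minimum.) -/
noncomputable def edgeExpansion (H : SimpleGraph V) : ℝ :=
  sInf {x : ℝ | ∃ S : Finset V, 0 < S.card ∧ 2 * S.card ≤ Fintype.card V ∧
    x = ((H.interedges S Sᶜ).card : ℝ) / (S.card : ℝ)}

/-- A graph is an edge-expander if its edge-expansion exceeds `1/3`. -/
def IsEdgeExpander (H : SimpleGraph V) : Prop :=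
  1 / 3 < edgeExpansion H

/-- `H` is the outcome of a `d`-round play of the cut-matching game inside `G`, in which the
matching player never reuses an edge: in round `i` the cut player chooses the bisection
`(S i, (S i)ᶜ)` and the matching player answers with a perfect matching `M i` of `G` all of whose
edges cross it; the matchings are pairwise edge-disjoint and `H` is their union. -/
def IsCutMatchingOutcome (G H : SimpleGraph V) (d : ℕ) : Prop :=
  ∃ (S : Fin d → Finset V) (M : Fin d → G.Subgraph),
    (∀ i, 2 * (S i).card = Fintype.card V) ∧
    (∀ i, (M i).IsPerfectMatching) ∧
    (∀ i u v, (M i).Adj u v → (u ∈ S i ↔ v ∉ S i)) ∧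
    (∀ i j, i ≠ j → Disjoint (M i).edgeSet (M j).edgeSet) ∧
    ∀ u v, H.Adj u v ↔ ∃ i, (M i).Adj u v

open Classical in
/-- `H` is a `d`-regular edge-expander contained in `G`, obtained as the union of the `d`
disjoint perfect matchings of a play of the cut-matching game. -/
def IsRegularExpanderIn (G H : SimpleGraph V) (d : ℕ) : Prop :=
  H ≤ G ∧ H.IsRegularOfDegree d ∧ IsEdgeExpander H ∧ IsCutMatchingOutcome G H d

end Graphs

/-! ### Randomized polynomial time

Programs of a random access machine with finitely many two-dimensional arrays of natural numbers.
The only arithmetic operations are addition and truncated subtraction, at unit cost; hence numbers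
have `O(T + log n)` bits after `T` steps, and polynomially many steps are the same as
polynomial time on a Turing machine. -/

/-- A memory: `s a i j` is the content of the cell `(i, j)` of the array `a`. -/
abbrev Mem := ℕ → ℕ → ℕ → ℕ

/-- Arithmetic expressions; `cell a i j` reads the array `a` at the computed position `(i, j)`. -/
inductive Expr : Type
  | const (k : ℕ) : Expr
  | cell (a : ℕ) (i j : Expr) : Expr
  | add (e f : Expr) : Expr
  | sub (e f : Expr) : Expr

/-- The value of an expression. -/
def Expr.eval (s : Mem) : Expr → ℕ
  | .const k => k
  | .cell a i j => s a (i.eval s) (j.eval s)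
  | .add e f => e.eval s + f.eval s
  | .sub e f => e.eval s - f.eval s

/-- The number of elementary operations needed to evaluate an expression. -/
def Expr.cost : Expr → ℕ
  | .const _ => 1
  | .cell _ i j => i.cost + j.cost + 1
  | .add e f => e.cost + f.cost + 1
  | .sub e f => e.cost + f.cost + 1

/-- Programs; a test `e` succeeds if the value of `e` is not `0`. -/
inductive Prog : Type
  | skip : Prog
  | assign (a : ℕ) (i j e : Expr) : Prog
  | seq (c d : Prog) : Prog
  | ite (e : Expr) (c d : Prog) : Prog
  | while (e : Expr) (c : Prog) : Prog

/-- Writing the value `v` to the cell `(i, j)` of the array `a`. -/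
def Mem.write (s : Mem) (a i j v : ℕ) : Mem :=
  fun a' i' j' => if a' = a ∧ i' = i ∧ j' = j then v else s a' i' j'

/-- `Exec c s s' t`: the program `c`, started in the memory `s`, halts in the memory `s'` after
exactly `t` steps. -/
inductive Exec : Prog → Mem → Mem → ℕ → Prop
  | skip (s : Mem) : Exec .skip s s 1
  | assign (a : ℕ) (i j e : Expr) (s : Mem) :
      Exec (.assign a i j e) s (s.write a (i.eval s) (j.eval s) (e.eval s))
        (i.cost + j.cost + e.cost + 1)
  | seq {c d : Prog} {s s' s'' : Mem} {t t' : ℕ} :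
      Exec c s s' t → Exec d s' s'' t' → Exec (.seq c d) s s'' (t + t')
  | ite_true {e : Expr} {c d : Prog} {s s' : Mem} {t : ℕ} :
      e.eval s ≠ 0 → Exec c s s' t → Exec (.ite e c d) s s' (e.cost + 1 + t)
  | ite_false {e : Expr} {c d : Prog} {s s' : Mem} {t : ℕ} :
      e.eval s = 0 → Exec d s s' t → Exec (.ite e c d) s s' (e.cost + 1 + t)
  | while_true {e : Expr} {c : Prog} {s s' s'' : Mem} {t t' : ℕ} :
      e.eval s ≠ 0 → Exec c s s' t → Exec (.while e c) s' s'' t' →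
      Exec (.while e c) s s'' (e.cost + 1 + t + t')
  | while_false {e : Expr} {c : Prog} {s : Mem} :
      e.eval s = 0 → Exec (.while e c) s s (e.cost + 1)

open Classical in
/-- The initial memory on the input graph `G` with the string `r` of random bits: the cell `(0, 0)`
of the array `0` holds the number `n` of vertices, the array `1` holds the adjacency matrix of `G`,
the column `0` of the array `2` holds the random bits, and all other cells are `0`. -/
noncomputable def initMem {n m : ℕ} (G : SimpleGraph (Fin n)) (r : Fin m → Bool) : Mem :=
  fun a i j =>
    if a = 0 then (if i = 0 ∧ j = 0 then n else 0)
    else if a = 1 then (if ∃ (hi : i < n) (hj : j < n), G.Adj ⟨i, hi⟩ ⟨j, hj⟩ then 1 else 0)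
    else if a = 2 then (if ∃ h : i < m, j = 0 ∧ r ⟨i, h⟩ = true then 1 else 0)
    else 0

open Classical in
/-- On input `G` with the random bits `r`, the program `A` halts with the adjacency matrix of `H`
in the array `3`. -/
def Outputs {n m : ℕ} (A : Prog) (G : SimpleGraph (Fin n)) (r : Fin m → Bool)
    (H : SimpleGraph (Fin n)) : Prop :=
  ∃ (s : Mem) (t : ℕ), Exec A (initMem G r) s t ∧
    ∀ i j : Fin n, s 3 i j = if H.Adj i j then 1 else 0

/-- The program `A` runs in randomized polynomial time with the bound `p`: on every graph with `n`
vertices and for every string of `p n` random bits, it halts after at most `p n` steps. -/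
def RunsInTime (A : Prog) (p : Polynomial ℕ) : Prop :=
  ∀ (n : ℕ) (G : SimpleGraph (Fin n)) (r : Fin (p.eval n) → Bool),
    ∃ (s : Mem) (t : ℕ), Exec A (initMem G r) s t ∧ t ≤ p.eval n

/-- The probability of an event over `m` independent fair random bits. -/
noncomputable def coinProb {m : ℕ} (E : Set (Fin m → Bool)) : ℝ :=
  (E.ncard : ℝ) / 2 ^ m

end SparseExpander

/-! Follow the lazy walk that, for each matching in turn, averages the mass distributions at the two
ends of every matching edge; let the potential be the squared distance of its matrix from the
uniform one. A new matching `f` lowers the potential by a quarter of the sum of the squared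
distances between the rows at `w` and `f w` (`potential_cons`). Over all ordered pairs these
distances add up to 2n times the potential, and if each vertex misses at most n/4 vertices, itself
included, the edges carry at least half of that (`potential_le_sum_walkDist`). About n/16 disjoint
edges chosen greedily by weight capture a 1/(18n) fraction of the edge weight
(`GreedyInv.sum_weight_le`), and density allows completing them to a perfect matching along
augmenting paths of three edges that leave them alone (`IsPartialMatching.exists_augment`). So a
round multiplies the potential by at most 71/72 (`roundCode_spec`), and 216⌈log₂ n⌉ rounds bring it
down to 1/n².

A nearly uniform walk has carried a constant fraction of the mass of any set of at most n/2 vertices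
out of it, while a crossing edge carries at most 1/2 (`outflow_le`); this gives the expansion
(`card_lt_sum_crossing`). Each vertex loses only O(log n) edges to earlier rounds, which the slack
δn absorbs.

The bisections are no constraint, since every perfect matching crosses some bisection. Both halves
come from one deterministic program that ignores its random bits and always succeeds; its degree
O(log n) also meets the bound O(log² n). Its correctness is proved by loop invariants
(`Code.run_loop`), its running time by `Code.exec`. -/

namespace SparseExpander

/-! ### The lazy walk along a list of matchings -/

section Walk

open Finset

/-- The mass at `w` of the commodity that started at `u`, after averaging along the matchings of
the list, the head of the list last. A matching is given by its partner function. -/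
noncomputable def walk {V : Type*} [DecidableEq V] : List (V → V) → V → V → ℝ
  | [], w, u => if w = u then 1 else 0
  | f :: l, w, u => (walk l w u + walk l (f w) u) / 2

theorem walk_nonneg {V : Type*} [DecidableEq V] (l : List (V → V)) (w u : V) : 0 ≤ walk l w u := by
  induction l generalizing w with
  | nil => unfold walk; split_ifs <;> norm_num
  | cons f l ih => have := ih w; have := ih (f w); unfold walk; linarith

theorem sum_comp_involutive {V : Type*} [Fintype V] {M : Type*} [AddCommMonoid M] {f : V → V}
    (hf : Function.Involutive f) (x : V → M) : ∑ w, x (f w) = ∑ w, x w :=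
  Equiv.sum_comp hf.toPerm x

variable {V : Type*} [Fintype V] [DecidableEq V]

/-- The squared distance of the mass distributions at two vertices. -/
noncomputable def walkDist (l : List (V → V)) (v w : V) : ℝ :=
  ∑ u, (walk l v u - walk l w u) ^ 2

/-- The squared distance of the walk from uniformity. -/
noncomputable def potential (l : List (V → V)) : ℝ :=
  ∑ w, ∑ u, (walk l w u - 1 / (Fintype.card V : ℝ)) ^ 2

theorem walk_row_sum (l : List (V → V)) (w : V) : ∑ u, walk l w u = 1 := by
  induction l generalizing w with
  | nil => simp [walk]
  | cons f l ih => simp only [walk, ← sum_div, sum_add_distrib, ih]; norm_num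

theorem walk_col_sum {l : List (V → V)} (hl : ∀ f ∈ l, Function.Involutive f) (u : V) :
    ∑ w, walk l w u = 1 := by
  induction l with
  | nil => simp [walk]
  | cons f l ih =>
    have h := ih fun g hg => hl g (List.mem_cons_of_mem _ hg)
    have h' := sum_comp_involutive (hl f List.mem_cons_self) fun w => walk l w u
    simp only [walk, ← sum_div, sum_add_distrib, h', h]
    norm_num

/-- Parallelogram law, ((a + b)/2)² = a²/2 + b²/2 − (a − b)²/4, at each entry; reindexing by the
involution turns both halves into the old potential. -/
theorem potential_cons {l : List (V → V)} {f : V → V} (hf : Function.Involutive f) :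
    potential (f :: l) = potential l - (∑ w, walkDist l w (f w)) / 4 := by
  have h := sum_comp_involutive hf
    fun w => ∑ u, (walk l w u - 1 / (Fintype.card V : ℝ)) ^ 2
  have h2 : potential (f :: l) = (∑ w, ∑ u, (walk l w u - 1 / (Fintype.card V : ℝ)) ^ 2) / 2
      + (∑ w, ∑ u, (walk l (f w) u - 1 / (Fintype.card V : ℝ)) ^ 2) / 2
      - (∑ w, walkDist l w (f w)) / 4 := by
    simp only [potential, walkDist, walk, sum_div, ← sum_add_distrib, ← sum_sub_distrib]
    refine sum_congr rfl fun w _ => sum_congr rfl fun u _ => ?_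
    ring
  rw [h2, h, potential]
  ring

theorem potential_nil_le : potential ([] : List (V → V)) ≤ Fintype.card V := by
  rcases isEmpty_or_nonempty V with hV | hV
  · simp [potential]
  have hn : (0 : ℝ) < Fintype.card V := by exact_mod_cast Fintype.card_pos
  have key : ∀ w u : V, (walk [] w u - 1 / (Fintype.card V : ℝ)) ^ 2 =
      (1 - 2 / (Fintype.card V : ℝ)) * (if w = u then 1 else 0)
        + (1 / (Fintype.card V : ℝ)) ^ 2 := by
    intro w u
    unfold walk
    split_ifs <;> ring
  simp only [potential, key, sum_add_distrib, ← mul_sum, sum_ite_eq, mem_univ, if_true,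
    sum_const, card_univ, nsmul_eq_mul]
  have : (Fintype.card V : ℝ) * (1 / (Fintype.card V : ℝ)) = 1 := by field_simp
  field_simp
  nlinarith

/-- In a dense graph the edges carry a constant fraction of all squared distances. -/
theorem potential_le_sum_walkDist {l : List (V → V)} (hl : ∀ f ∈ l, Function.Involutive f)
    (A : V → V → Prop) [DecidableRel A] (hs : ∀ u v, A u v → A v u)
    (hA : ∀ u, 4 * #{v | ¬ A u v} ≤ Fintype.card V) :
    (Fintype.card V : ℝ) * potential l ≤ ∑ u, ∑ v, if A u v then walkDist l u v else 0 := by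
  rcases isEmpty_or_nonempty V with hV | hV
  · simp
  have hn : (0 : ℝ) < Fintype.card V := by exact_mod_cast Fintype.card_pos
  set c : ℝ := 1 / (Fintype.card V : ℝ) with hc
  set N : V → ℝ := fun w => ∑ u, (walk l w u - c) ^ 2 with hN
  have hpot : potential l = ∑ w, N w := rfl
  have hN0 : ∀ w, 0 ≤ N w := fun w => sum_nonneg fun _ _ => sq_nonneg _
  have hle : ∀ u v, walkDist l u v ≤ 2 * N u + 2 * N v := by
    intro u v
    simp only [walkDist, hN, mul_sum, ← sum_add_distrib]
    refine sum_le_sum fun x _ => ?_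
    nlinarith [sq_nonneg (walk l u x - c + (walk l v x - c))]
  -- Columns of the walk sum to 1, so the deviations from uniformity cancel in each column and the
  -- mixed terms vanish.
  have hcross : ∑ u, ∑ v, ∑ x, (walk l u x - c) * (walk l v x - c) = 0 := by
    have h1 : ∀ x, ∑ v, (walk l v x - c) = 0 := by
      intro x
      rw [sum_sub_distrib, walk_col_sum hl]
      simp [hc]
    refine sum_eq_zero fun u _ => ?_
    rw [sum_comm]
    refine sum_eq_zero fun x _ => ?_
    rw [← mul_sum, h1, mul_zero]
  have hall : ∑ u, ∑ v, walkDist l u v = 2 * Fintype.card V * potential l := by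
    have : ∀ u v, walkDist l u v
        = N u + N v - 2 * ∑ x, (walk l u x - c) * (walk l v x - c) := by
      intro u v
      simp only [walkDist, hN, mul_sum, ← sum_add_distrib, ← sum_sub_distrib]
      exact sum_congr rfl fun x _ => by ring
    simp only [this, sum_sub_distrib, sum_add_distrib, ← mul_sum, hcross, sum_const, card_univ,
      nsmul_eq_mul, hpot]
    ring
  have hdeg : ∀ u, ((#{v | ¬ A u v} : ℕ) : ℝ) ≤ Fintype.card V / 4 := by
    intro u
    have : ((4 * #{v | ¬ A u v} : ℕ) : ℝ) ≤ Fintype.card V := by exact_mod_cast hA u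
    push_cast at this
    linarith
  -- Each non-edge has distance at most 2 N u + 2 N v, and each vertex lies in at most n/4 of them
  -- on either side: half of the total 2n · potential.
  have hfar : ∑ u, ∑ v, (if ¬ A u v then walkDist l u v else 0)
      ≤ Fintype.card V * potential l := by
    have h1 : ∑ u, ∑ v, (if ¬ A u v then N u else 0) ≤ Fintype.card V / 4 * potential l := by
      rw [hpot, mul_sum]
      refine sum_le_sum fun u _ => ?_
      rw [← sum_filter, sum_const, nsmul_eq_mul]
      exact mul_le_mul_of_nonneg_right (hdeg u) (hN0 u)
    have h2 : ∑ u, ∑ v, (if ¬ A u v then N v else 0) = ∑ u, ∑ v, (if ¬ A u v then N u else 0) := by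
      rw [sum_comm]
      refine sum_congr rfl fun u _ => sum_congr rfl fun v _ => ?_
      have : A v u ↔ A u v := ⟨hs _ _, hs _ _⟩
      simp [this]
    have h3 : ∑ u, ∑ v, (if ¬ A u v then walkDist l u v else 0) ≤
        2 * ∑ u, ∑ v, (if ¬ A u v then N u else 0)
          + 2 * ∑ u, ∑ v, (if ¬ A u v then N v else 0) := by
      simp only [mul_sum, ← sum_add_distrib]
      refine sum_le_sum fun u _ => sum_le_sum fun v _ => ?_
      split_ifs
      · simp
      · exact hle u v
    rw [h2] at h3
    linarith
  have hsplit : ∑ u, ∑ v, walkDist l u v = (∑ u, ∑ v, if A u v then walkDist l u v else 0)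
      + ∑ u, ∑ v, (if ¬ A u v then walkDist l u v else 0) := by
    simp only [← sum_add_distrib]
    refine sum_congr rfl fun u _ => sum_congr rfl fun v _ => ?_
    split_ifs <;> simp
  rw [hall] at hsplit
  linarith

/-! ### Edge expansion from a nearly uniform walk -/

/-- The number of edges of the matching `f` that leave `S`. -/
def crossing (f : V → V) (S : Finset V) : ℕ := #{w ∈ S | f w ∉ S}

/-- The mass `x w` at `w` that started in `S` lies in [0, 1]. Averaging changes the amount outside
`S` only along the crossing edges, by at most 1/2 on each. -/
theorem outflow_cons_le {l : List (V → V)} {f : V → V} (hf : Function.Involutive f)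
    (S : Finset V) : ∑ w ∈ Sᶜ, ∑ u ∈ S, walk (f :: l) w u
      ≤ ∑ w ∈ Sᶜ, ∑ u ∈ S, walk l w u + (crossing f S : ℝ) / 2 := by
  obtain ⟨x, hx⟩ : ∃ x : V → ℝ, ∀ w, x w = ∑ u ∈ S, walk l w u := ⟨_, fun _ => rfl⟩
  have hx0 : ∀ w, 0 ≤ x w := fun w => hx w ▸ sum_nonneg fun u _ => walk_nonneg l w u
  have hx1 : ∀ w, x w ≤ 1 := fun w => by
    rw [← walk_row_sum l w, hx]
    exact sum_le_sum_of_subset_of_nonneg (subset_univ S) fun u _ _ => walk_nonneg l w u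
  have hc : ∀ y : V → ℝ, ∑ w ∈ Sᶜ, y w = ∑ w, if w ∉ S then y w else 0 := by
    intro y
    rw [← sum_filter]
    congr 1
    ext w
    simp
  have h1 : ∑ w ∈ Sᶜ, ∑ u ∈ S, walk (f :: l) w u
      = (∑ w ∈ Sᶜ, x w) / 2 + (∑ w ∈ Sᶜ, x (f w)) / 2 := by
    simp only [walk, hx, sum_div, ← sum_add_distrib]
    exact sum_congr rfl fun w _ => sum_congr rfl fun u _ => by ring
  have h2 : ∑ w ∈ Sᶜ, x (f w) = ∑ w, if f w ∉ S then x w else 0 := by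
    rw [hc, ← sum_comp_involutive hf]
    simp only [hf _]
  have h3 : ∑ w ∈ Sᶜ, x (f w) ≤ ∑ w ∈ Sᶜ, x w + crossing f S := by
    have : (crossing f S : ℝ) = ∑ w, if w ∈ S ∧ f w ∉ S then (1 : ℝ) else 0 := by
      rw [crossing, sum_boole]
      congr 2
      ext w
      simp
    rw [h2, this, hc, ← sum_add_distrib]
    refine sum_le_sum fun w _ => ?_
    have := hx0 w
    have := hx1 w
    by_cases h : f w ∈ S <;> by_cases h' : w ∈ S <;> simp [h, h', hx0, hx1]
  rw [h1]
  simp only [← hx]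
  linarith

theorem outflow_le {l : List (V → V)} (hl : ∀ f ∈ l, Function.Involutive f) (S : Finset V) :
    ∑ w ∈ Sᶜ, ∑ u ∈ S, walk l w u ≤ ((l.map fun f => crossing f S).sum : ℕ) / (2 : ℝ) := by
  induction l with
  | nil =>
    simp only [walk, List.map_nil, List.sum_nil, Nat.cast_zero, zero_div]
    refine (sum_eq_zero fun w hw => sum_eq_zero fun u hu => if_neg ?_).le
    rintro rfl
    exact (mem_compl.1 hw) hu
  | cons f l ih =>
    have h := ih fun g hg => hl g (List.mem_cons_of_mem _ hg)
    have h' := outflow_cons_le (l := l) (hl f List.mem_cons_self) S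
    simp only [List.map_cons, List.sum_cons, Nat.cast_add]
    linarith

/-- If the walk is nearly uniform, then every set of at most half of the vertices is left by many
edges. -/
theorem card_lt_sum_crossing {l : List (V → V)} (hl : ∀ f ∈ l, Function.Involutive f)
    (hn : 16 ≤ Fintype.card V) (hpot : potential l ≤ 1 / (Fintype.card V : ℝ) ^ 2)
    (S : Finset V) (hS : 0 < #S) (hS2 : 2 * #S ≤ Fintype.card V) :
    #S < 3 * (l.map fun f => crossing f S).sum := by
  have hflow := outflow_le hl S
  set n : ℝ := (Fintype.card V : ℝ) with hnd
  have hn' : (16 : ℝ) ≤ n := by rw [hnd]; exact_mod_cast hn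
  have hn0 : 0 < n := by linarith
  have hs1 : (1 : ℝ) ≤ #S := by exact_mod_cast hS
  have hs2 : 2 * (#S : ℝ) ≤ n := by rw [hnd]; exact_mod_cast hS2
  have hcard : ((#Sᶜ : ℕ) : ℝ) = n - #S := by
    rw [card_compl, Nat.cast_sub (card_le_univ S)]
  -- Completing the square gives a lower bound whose error terms sum to at most n · potential.
  have hpt : ∀ w u, walk l w u ≥ 3 / 4 * (1 / n) - n * (walk l w u - 1 / n) ^ 2 := by
    intro w u
    have h0 : n * (1 / n) = 1 := by field_simp
    have : 0 ≤ n * ((walk l w u - 1 / n) + 1 / 2 * (1 / n)) ^ 2 := by positivity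
    have e : n * ((walk l w u - 1 / n) + 1 / 2 * (1 / n)) ^ 2 = n * (walk l w u - 1 / n) ^ 2
        + (walk l w u - 1 / n) * (n * (1 / n)) + 1 / 4 * (1 / n) * (n * (1 / n)) := by ring
    rw [h0] at e
    linarith
  have hsq : ∑ w ∈ Sᶜ, ∑ u ∈ S, (walk l w u - 1 / n) ^ 2 ≤ potential l := by
    refine (sum_le_sum fun w _ => ?_).trans
      (sum_le_sum_of_subset_of_nonneg (subset_univ Sᶜ)
        fun w _ _ => sum_nonneg fun u _ => sq_nonneg _)
    exact sum_le_sum_of_subset_of_nonneg (subset_univ S) fun u _ _ => sq_nonneg _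
  have hlow : ∑ w ∈ Sᶜ, ∑ u ∈ S, walk l w u ≥ (n - #S) * (#S * (3 / 4 * (1 / n)))
      - n * potential l := by
    have h1 : ∑ w ∈ Sᶜ, ∑ u ∈ S, (3 / 4 * (1 / n) - n * (walk l w u - 1 / n) ^ 2)
        = (n - #S) * (#S * (3 / 4 * (1 / n)))
          - n * ∑ w ∈ Sᶜ, ∑ u ∈ S, (walk l w u - 1 / n) ^ 2 := by
      simp only [sum_sub_distrib, ← mul_sum, sum_const, nsmul_eq_mul, hcard]
      ring
    have h2 := sum_le_sum fun w (_ : w ∈ Sᶜ) => sum_le_sum fun u (_ : u ∈ S) => hpt w u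
    have h3 := mul_le_mul_of_nonneg_left hsq hn0.le
    linarith
  have hp : n * potential l ≤ 1 / 16 := by
    have h1 := mul_le_mul_of_nonneg_left hpot hn0.le
    have h2 : n * (1 / n ^ 2) = 1 / n := by field_simp
    have h3 : 1 / n ≤ 1 / 16 := one_div_le_one_div_of_le (by norm_num) hn'
    linarith
  -- Uses n − |S| ≥ n/2. The outflow is then at least 3|S|/8 − 1/16 ≥ 5|S|/16, so at least 5|S|/8 >
  -- |S|/3 edges cross.
  have hmain : 3 / 8 * (#S : ℝ) ≤ (n - #S) * (#S * (3 / 4 * (1 / n))) := by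
    rw [show (n - #S) * (#S * (3 / 4 * (1 / n))) = 3 / 4 * (n - #S) * #S / n by ring,
      le_div_iff₀ hn0]
    nlinarith
  have : (#S : ℝ) < (3 * (l.map fun f => crossing f S).sum : ℕ) := by
    push_cast at hflow ⊢
    linarith
  exact_mod_cast this

end Walk

/-! ### Lists of disjoint perfect matchings -/

section MatchingList

open Finset

variable {V : Type*}

/-- A list of pairwise disjoint perfect matchings of `G`, given by their partner functions. -/
structure IsMatchingList (G : SimpleGraph V) (l : List (V → V)) : Prop where
  involutive : ∀ f ∈ l, Function.Involutive f
  adj : ∀ f ∈ l, ∀ u, G.Adj u (f u)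
  pairwise : l.Pairwise fun f g => ∀ u, f u ≠ g u

namespace IsMatchingList

variable {G : SimpleGraph V} {l : List (V → V)}

/-- The union of the matchings of the list. -/
def union (h : IsMatchingList G l) : SimpleGraph V where
  Adj u v := ∃ f ∈ l, f u = v
  symm := ⟨by
    rintro u v ⟨f, hf, rfl⟩
    exact ⟨f, hf, h.involutive f hf u⟩⟩
  loopless := ⟨by
    rintro u ⟨f, hf, hu⟩
    exact (h.adj f hf u).ne hu.symm⟩

theorem nodup_map_eval (h : IsMatchingList G l) (u : V) : (l.map fun f => f u).Nodup :=
  List.Pairwise.map _ (fun _ _ hfg => hfg u) h.pairwise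

/-- The perfect matching with the partner function `f` as a subgraph. -/
def toSubgraph {f : V → V} (hf : Function.Involutive f) (hadj : ∀ u, G.Adj u (f u)) :
    G.Subgraph where
  verts := Set.univ
  Adj u v := f u = v
  adj_sub := by
    rintro u v rfl
    exact hadj u
  edge_vert _ := Set.mem_univ _
  symm := ⟨by
    rintro u v rfl
    exact hf u⟩

/-- A perfect matching crosses the bisection that collects one end of each of its edges; a numbering
of the vertices selects the lower end. -/
theorem isCutMatchingOutcome [Fintype V] (h : IsMatchingList G l) :
    IsCutMatchingOutcome G h.union l.length := by
  classical
  let e := Fintype.equivFin V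
  refine ⟨fun i => {u | e u < e (l.get i u)}, fun i => toSubgraph (f := l.get i)
    (h.involutive _ (l.get_mem i)) (h.adj _ (l.get_mem i)), fun i => ?_, fun i => ⟨?_, ?_⟩,
    fun i u v huv => ?_, fun i j hij => ?_, fun u v => ?_⟩
  · have hi := h.involutive _ (l.get_mem i)
    have hne : ∀ u, e u ≠ e (l.get i u) := fun u =>
      fun hu => (h.adj _ (l.get_mem i) u).ne (e.injective hu)
    have h1 : #{u | ¬ e u < e (l.get i u)} = #{u | e u < e (l.get i u)} := by
      refine Finset.card_bij (fun u _ => l.get i u) ?_ (fun _ _ _ _ huv => hi.injective huv) ?_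
      · intro u hu
        simp only [mem_filter, mem_univ, true_and] at hu ⊢
        rw [hi u]
        exact lt_of_le_of_ne (not_lt.1 hu) (hne u).symm
      · intro u hu
        refine ⟨l.get i u, ?_, hi u⟩
        simp only [mem_filter, mem_univ, true_and] at hu ⊢
        rw [hi u]
        exact hu.le.not_gt
    have h2 := Finset.card_filter_add_card_filter_not (s := (univ : Finset V))
      (fun u => e u < e (l.get i u))
    rw [card_univ] at h2
    change 2 * #{u | e u < e (l.get i u)} = _
    omega
  · intro u _
    exact ⟨l.get i u, rfl, fun v hv => Eq.symm hv⟩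
  · intro u
    exact Set.mem_univ u
  · have hi := h.involutive _ (l.get_mem i)
    have hne := (h.adj _ (l.get_mem i) u).ne
    obtain rfl : l.get i u = v := huv
    simp only [mem_filter, mem_univ, true_and, hi u, not_lt]
    refine ⟨le_of_lt, fun hu => lt_of_le_of_ne hu fun heq => hne (e.injective heq)⟩
  · rw [Set.disjoint_left]
    intro x
    induction x using Sym2.ind with
    | _ u v =>
      intro hi hj
      have hi : l.get i u = v := hi
      have hj : l.get j u = v := hj
      rcases lt_or_gt_of_ne hij with hlt | hlt
      · exact List.pairwise_iff_get.1 h.pairwise i j hlt u (hi.trans hj.symm)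
      · exact List.pairwise_iff_get.1 h.pairwise j i hlt u (hj.trans hi.symm)
  · constructor
    · rintro ⟨f, hf, rfl⟩
      obtain ⟨i, rfl⟩ := List.get_of_mem hf
      exact ⟨i, rfl⟩
    · rintro ⟨i, hi⟩
      exact ⟨l.get i, l.get_mem i, hi⟩

/-- Disjointness of the matchings ensures that no crossing edge is counted twice. -/
theorem sum_crossing_eq [Fintype V] [DecidableEq V] (h : IsMatchingList G l) (S : Finset V) :
    (l.map fun f => crossing f S).sum = #{p ∈ S ×ˢ Sᶜ | ∃ f ∈ l, f p.1 = p.2} := by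
  induction l with
  | nil => simp
  | cons f l ih =>
    have hl : IsMatchingList G l :=
      ⟨fun g hg => h.involutive g (List.mem_cons_of_mem _ hg),
        fun g hg => h.adj g (List.mem_cons_of_mem _ hg), (List.pairwise_cons.1 h.pairwise).2⟩
    have hf := (List.pairwise_cons.1 h.pairwise).1
    rw [List.map_cons, List.sum_cons, ih hl]
    have hc : crossing f S = #{p ∈ S ×ˢ Sᶜ | f p.1 = p.2} := by
      refine Finset.card_bij (fun w _ => (w, f w)) ?_ ?_ ?_
      · intro w hw
        simpa using hw
      · intro w _ w' _ hww
        exact congrArg Prod.fst hww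
      · rintro ⟨w, v⟩ hp
        simp only [mem_filter, mem_product, mem_compl] at hp
        obtain ⟨⟨hw, hv⟩, rfl⟩ := hp
        exact ⟨w, by simp [hw, hv], rfl⟩
    rw [hc, ← card_union_of_disjoint]
    · congr 1
      ext p
      simp only [mem_union, mem_filter, List.mem_cons, exists_eq_or_imp]
      tauto
    · rw [Finset.disjoint_left]
      rintro p hp hp'
      obtain ⟨g, hg, hgp⟩ := (mem_filter.1 hp').2
      exact hf g hg p.1 ((mem_filter.1 hp).2.trans hgp.symm)

/-- A list of disjoint perfect matchings whose union expands yields a regular expander. -/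
theorem isRegularExpanderIn [Fintype V] [DecidableEq V] (h : IsMatchingList G l)
    (hV : 2 ≤ Fintype.card V)
    (hexp : ∀ S : Finset V, 0 < #S → 2 * #S ≤ Fintype.card V →
      #S < 3 * (l.map fun f => crossing f S).sum) :
    IsRegularExpanderIn G h.union l.length := by
  classical
  refine ⟨?_, ?_, ?_, h.isCutMatchingOutcome⟩
  · rintro u v ⟨f, hf, rfl⟩
    exact h.adj f hf u
  · intro u
    rw [← SimpleGraph.card_neighborFinset_eq_degree, ← List.length_map (fun f : V → V => f u),
      ← List.toFinset_card_of_nodup (h.nodup_map_eval u)]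
    congr 1
    ext v
    simp only [SimpleGraph.mem_neighborFinset, List.mem_toFinset, List.mem_map]
    rfl
  · rw [IsEdgeExpander, edgeExpansion]
    set X : Set ℝ := {x : ℝ | ∃ S : Finset V, 0 < #S ∧ 2 * #S ≤ Fintype.card V ∧
      x = ((h.union.interedges S Sᶜ).card : ℝ) / (#S : ℝ)} with hX
    -- The set of ratios is finite and nonempty, so the infimum is attained and a strict bound for
    -- each `S` suffices.
    have hfin : X.Finite := by
      refine (Set.finite_range fun S : Finset V =>
        ((h.union.interedges S Sᶜ).card : ℝ) / (#S : ℝ)).subset ?_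
      rintro x ⟨S, _, _, rfl⟩
      exact ⟨S, rfl⟩
    have hne : X.Nonempty := by
      obtain ⟨v⟩ : Nonempty V := Fintype.card_pos_iff.1 (by omega)
      exact ⟨_, {v}, by simp, by simpa using hV, rfl⟩
    suffices 1 / 3 < sInf X by convert this
    obtain ⟨S, hS, hS2, hx⟩ := hne.csInf_mem hfin
    rw [hx]
    have h1 := hexp S hS hS2
    rw [h.sum_crossing_eq S] at h1
    have h2 : #{p ∈ S ×ˢ Sᶜ | ∃ f ∈ l, f p.1 = p.2} = (h.union.interedges S Sᶜ).card := by
      congr 1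
      ext p
      rw [SimpleGraph.mem_interedges_iff, mem_filter, mem_product, and_assoc]
      rfl
    rw [h2] at h1
    have hS' : (0 : ℝ) < #S := by exact_mod_cast hS
    have h3 : (#S : ℝ) < 3 * (h.union.interedges S Sᶜ).card := by exact_mod_cast h1
    rw [div_lt_div_iff₀ (by norm_num) hS']
    linarith

/-- The conjugate of a list of matchings along a bijection of the vertex sets. -/
theorem conj {W : Type*} (e : V ≃ W) {G : SimpleGraph V} {l : List (W → W)}
    (h : IsMatchingList (G.comap e.symm) l) :
    IsMatchingList G (l.map fun f v => e.symm (f (e v))) where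
  involutive := by
    simp only [List.mem_map]
    rintro _ ⟨f, hf, rfl⟩ v
    simp [h.involutive f hf (e v)]
  adj := by
    simp only [List.mem_map]
    rintro _ ⟨f, hf, rfl⟩ v
    simpa using h.adj f hf (e v)
  pairwise := by
    refine List.Pairwise.map _ (fun f g hfg v => ?_) h.pairwise
    exact fun hv => hfg (e v) (e.symm.injective hv)

end IsMatchingList

theorem crossing_conj {V W : Type*} [DecidableEq V] [DecidableEq W] (e : V ≃ W) (f : W → W)
    (S : Finset V) : crossing (fun v => e.symm (f (e v))) S = crossing f (S.map e.toEmbedding) := by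
  refine Finset.card_bij (fun v _ => e v) ?_ (fun _ _ _ _ h => e.injective h) ?_
  · intro v hv
    simpa [Finset.mem_map_equiv] using hv
  · intro w hw
    refine ⟨e.symm w, ?_, by simp⟩
    simpa [Finset.mem_map_equiv] using hw

/-! ### Integer weights -/

/-- The Gram matrix of the rows of the walk, scaled to an integer matrix. -/
def gram [DecidableEq V] : List (V → V) → V → V → ℕ
  | [], u, v => if u = v then 1 else 0
  | f :: l, u, v => gram l u v + gram l u (f v) + gram l (f u) v + gram l (f u) (f v)

/-- The scaled squared distance of two rows of the walk. -/
def gramWeight [DecidableEq V] (l : List (V → V)) (u v : V) : ℕ :=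
  gram l u u + gram l v v - (gram l u v + gram l u v)

/-- Averaging divides inner products of sums of two rows by 4. The factor 4 per matching clears the
denominators, so that the program compares weights exactly in ℕ. -/
theorem cast_gram [Fintype V] [DecidableEq V] (l : List (V → V)) (u v : V) :
    (gram l u v : ℝ) = 4 ^ l.length * ∑ x, walk l u x * walk l v x := by
  induction l generalizing u v with
  | nil => simp [gram, walk]
  | cons f l ih =>
    simp only [gram, Nat.cast_add, ih, List.length_cons, ← mul_add, ← sum_add_distrib, pow_succ,
      mul_assoc, mul_sum, walk]
    exact sum_congr rfl fun x _ => by ring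

theorem cast_gramWeight [Fintype V] [DecidableEq V] (l : List (V → V)) (u v : V) :
    (gramWeight l u v : ℝ) = 4 ^ l.length * walkDist l u v := by
  have h : (gram l u u : ℝ) + gram l v v - (gram l u v + gram l u v)
      = 4 ^ l.length * walkDist l u v := by
    simp only [cast_gram, walkDist, ← mul_add, ← mul_sub, ← sum_add_distrib, ← sum_sub_distrib]
    congr 1
    exact sum_congr rfl fun x _ => by ring
  -- The weight is a squared distance, so the truncated subtraction loses nothing.
  have h0 : 0 ≤ (4 : ℝ) ^ l.length * walkDist l u v :=
    mul_nonneg (by positivity) (sum_nonneg fun _ _ => sq_nonneg _)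
  rw [gramWeight, Nat.cast_sub]
  · push_cast
    exact h
  · have : (gram l u v : ℝ) + gram l u v ≤ gram l u u + gram l v v := by linarith
    exact_mod_cast this

theorem gramWeight_self [DecidableEq V] (l : List (V → V)) (u : V) : gramWeight l u u = 0 :=
  Nat.sub_self _

theorem gramWeight_comm [Fintype V] [DecidableEq V] (l : List (V → V)) (u v : V) :
    gramWeight l u v = gramWeight l v u := by
  have h : (gramWeight l u v : ℝ) = gramWeight l v u := by
    rw [cast_gramWeight, cast_gramWeight]
    congr 1
    exact sum_congr rfl fun x _ => by ring
  exact_mod_cast h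

end MatchingList

/-! ### Greedy matchings and augmentation -/

section PartialMatching

open Finset

variable {V : Type*}

/-- A matching of the relation `A`, given by its partner function, which fixes the unmatched
elements. -/
def IsPartialMatching (A : V → V → Prop) (m : V → V) : Prop :=
  (∀ u, m (m u) = u) ∧ ∀ u, m u ≠ u → A u (m u)

/-- Makes `a` and `b` partners. -/
def link [DecidableEq V] (m : V → V) (a b : V) : V → V :=
  Function.update (Function.update m a b) b a

variable [DecidableEq V]

theorem link_apply (m : V → V) (a b u : V) :
    link m a b u = if u = b then a else if u = a then b else m u := by
  simp [link, Function.update_apply]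

variable {A : V → V → Prop} {m : V → V}

theorem IsPartialMatching.link (h : IsPartialMatching A m) (hs : ∀ u v, A u v → A v u) {a b : V}
    (ha : m a = a) (hb : m b = b) (hA : A a b) : IsPartialMatching A (link m a b) := by
  obtain ⟨h1, h2⟩ := h
  have := hs a b hA
  constructor
  · intro u
    simp only [link_apply]
    grind
  · intro u
    simp only [link_apply]
    grind

/-- The edge between `x` and `m x` is exchanged for the outer edges of the path a, x, m x, b. After
the inner `link` alone the function is not an involution, because `m x` still points to `x`; hence
`IsPartialMatching.link` cannot be applied twice. -/
theorem IsPartialMatching.augment (h : IsPartialMatching A m) (hs : ∀ u v, A u v → A v u)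
    {a b x : V} (ha : m a = a) (hb : m b = b) (hab : a ≠ b) (hx : m x ≠ x) (hax : A a x)
    (hbx : A b (m x)) :
    IsPartialMatching A (SparseExpander.link (SparseExpander.link m a x) b (m x)) := by
  obtain ⟨h1, h2⟩ := h
  have := hs a x hax
  have := hs b (m x) hbx
  constructor
  · intro u
    simp only [link_apply]
    grind
  · intro u
    simp only [link_apply]
    grind

/-- In a dense relation, two unmatched elements have an augmentation that avoids a small set of
protected elements. -/
theorem IsPartialMatching.exists_augment [Fintype V] [DecidableRel A]
    (h : IsPartialMatching A m) (R : Finset V)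
    (hR : 8 * #R ≤ Fintype.card V) (hA : ∀ u, 4 * #{v | ¬ A u v} ≤ Fintype.card V)
    (hmax : ∀ u v, m u = u → m v = v → ¬ A u v) {a b : V} (ha : m a = a) :
    ∃ x, x ∉ R ∧ m x ≠ x ∧ A a x ∧ A b (m x) := by
  by_contra hno
  push Not at hno
  have hpos : 0 < Fintype.card V := Fintype.card_pos_iff.2 ⟨a⟩
  -- If no `x` works, all vertices are covered by sets of sizes at most n/8, n/4 and n/4, which is
  -- impossible. A neighbor of the free vertex `a` is matched by maximality.
  have hcov : (univ : Finset V) ⊆ R ∪ ({v | ¬ A a v} : Finset V) ∪ ({v | ¬ A b (m v)} : Finset V) := by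
    intro x _
    simp only [mem_union, mem_filter, mem_univ, true_and]
    by_cases hxR : x ∈ R
    · exact Or.inl (Or.inl hxR)
    by_cases hax : A a x
    · refine Or.inr (hno x hxR (fun hx => hmax a x ha hx hax) hax)
    · exact Or.inl (Or.inr hax)
  have hb : #{v | ¬ A b (m v)} = #{v | ¬ A b v} := by
    refine Finset.card_bij (fun v _ => m v) (fun v hv => by simpa using hv)
      (fun u _ v _ huv => by rw [← h.1 u, ← h.1 v, huv]) fun v hv => ⟨m v, ?_, h.1 v⟩
    simpa [h.1 v] using hv
  have h1 := card_le_card hcov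
  have h2 := card_union_le (R ∪ ({v | ¬ A a v} : Finset V)) {v | ¬ A b (m v)}
  have h3 := card_union_le R {v | ¬ A a v}
  have h4 := hA a
  have h5 := hA b
  rw [card_univ] at h1
  omega

/-- The invariant of the greedy choice of heavy edges, after `i` choices. -/
structure GreedyInv [Fintype V] (A : V → V → Prop) [DecidableRel A] (w : V → V → ℕ) (i : ℕ)
    (m : V → V) : Prop where
  matching : IsPartialMatching A m
  card_le : #{u | m u ≠ u} ≤ 2 * i
  -- Every chosen edge was at least as heavy as any edge still available, and the sum over `x`
  -- counts it twice.
  heavy : ∀ u v, A u v → m u = u → m v = v → 2 * i * w u v ≤ ∑ x, w x (m x)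
  touched : (∑ u, ∑ v, if A u v ∧ (m u ≠ u ∨ m v ≠ v) then w u v else 0)
    ≤ 2 * Fintype.card V * ∑ x, w x (m x)

variable [Fintype V] [DecidableRel A] {w : V → V → ℕ} {i : ℕ}

theorem greedyInv_zero (A : V → V → Prop) [DecidableRel A] (w : V → V → ℕ) :
    GreedyInv A w 0 id where
  matching := ⟨fun _ => rfl, fun _ h => absurd rfl h⟩
  card_le := by simp
  heavy := by simp
  touched := by simp

/-- For a step with no available edge of positive weight: nothing is chosen, but the count of steps
still advances. -/
theorem GreedyInv.succ_of_weight_eq_zero (h : GreedyInv A w i m)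
    (h0 : ∀ u v, A u v → m u = u → m v = v → w u v = 0) : GreedyInv A w (i + 1) m where
  matching := h.matching
  card_le := by have := h.card_le; omega
  heavy u v hA hu hv := by simp [h0 u v hA hu hv]
  touched := h.touched

theorem GreedyInv.link (h : GreedyInv A w i m) (hs : ∀ u v, A u v → A v u)
    (hi : ∀ u, ¬ A u u) (hw : ∀ u, w u u = 0) (hws : ∀ u v, w u v = w v u) {a b : V}
    (hA : A a b) (ha : m a = a) (hb : m b = b)
    (hmax : ∀ u v, A u v → m u = u → m v = v → w u v ≤ w a b) :
    GreedyInv A w (i + 1) (link m a b) := by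
  have hab : a ≠ b := by rintro rfl; exact hi a hA
  have hfix : ∀ u, SparseExpander.link m a b u = u → m u = u := by
    intro u
    rw [link_apply]
    grind
  have hsum : ∑ x, w x (SparseExpander.link m a b x) = ∑ x, w x (m x) + 2 * w a b := by
    have hpt : ∀ x, w x (SparseExpander.link m a b x)
        = w x (m x) + ((if x = a then w a b else 0) + (if x = b then w a b else 0)) := by
      intro x
      rw [link_apply]
      by_cases hxb : x = b
      · subst hxb
        simp [hab.symm, hb, hw, hws]
      · by_cases hxa : x = a
        · subst hxa
          simp [hxb, ha, hw]
        · simp [hxa, hxb]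
    simp only [hpt, sum_add_distrib, sum_ite_eq', mem_univ, if_true]
    ring
  refine ⟨h.matching.link hs ha hb hA, ?_, ?_, ?_⟩
  · have hsub : ({u | SparseExpander.link m a b u ≠ u} : Finset V)
        ⊆ ({u | m u ≠ u} : Finset V) ∪ {a, b} := by
      intro u
      simp only [mem_filter, mem_univ, true_and, mem_union, mem_insert, mem_singleton, link_apply]
      grind
    have h1 := card_le_card hsub
    have h2 := card_union_le ({u | m u ≠ u} : Finset V) {a, b}
    have h3 := h.card_le
    have h4 := card_le_two (a := a) (b := b)
    omega
  · intro u v huv hu hv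
    rw [hsum]
    have h1 := h.heavy u v huv (hfix u hu) (hfix v hv)
    have h2 := hmax u v huv (hfix u hu) (hfix v hv)
    linarith
  · rw [hsum]
    -- A newly touched pair contains `a` or `b` and weighs at most `w a b`. There are at most 4n
    -- such ordered pairs, while the matching sum grows by 2 `w a b`.
    have hpt : ∀ u v, (if A u v ∧ (SparseExpander.link m a b u ≠ u ∨
          SparseExpander.link m a b v ≠ v) then w u v else 0)
        ≤ (if A u v ∧ (m u ≠ u ∨ m v ≠ v) then w u v else 0)
          + (((if u = a then w a b else 0) + (if u = b then w a b else 0))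
            + ((if v = a then w a b else 0) + (if v = b then w a b else 0))) := by
      intro u v
      by_cases hold : A u v ∧ (m u ≠ u ∨ m v ≠ v)
      · rw [if_pos hold]
        split_ifs <;> omega
      · by_cases hnew : A u v ∧ (SparseExpander.link m a b u ≠ u ∨
          SparseExpander.link m a b v ≠ v)
        · rw [if_pos hnew, if_neg hold]
          have hu : m u = u := by by_contra hu; exact hold ⟨hnew.1, Or.inl hu⟩
          have hv : m v = v := by by_contra hv; exact hold ⟨hnew.1, Or.inr hv⟩
          have hle := hmax u v hnew.1 hu hv
          have hone : u = a ∨ u = b ∨ v = a ∨ v = b := by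
            have h2 := hnew.2
            rw [link_apply, link_apply] at h2
            grind
          rcases hone with rfl | rfl | rfl | rfl <;> simp only [if_true] <;> omega
        · rw [if_neg hnew]
          exact Nat.zero_le _
    refine (sum_le_sum fun u _ => sum_le_sum fun v _ => hpt u v).trans ?_
    simp only [sum_add_distrib, sum_ite_eq', mem_univ, if_true, sum_const, card_univ,
      smul_eq_mul, ← mul_sum]
    have := h.touched
    linarith

/-- After sufficiently many choices the greedy matching carries a constant fraction of the average
weight. -/
theorem GreedyInv.sum_weight_le (h : GreedyInv A w i m) (hV : Fintype.card V ≤ 32 * i) :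
    (∑ u, ∑ v, if A u v then w u v else 0) ≤ 18 * Fintype.card V * ∑ x, w x (m x) := by
  set W := ∑ x, w x (m x) with hW
  set n := Fintype.card V with hn
  have hsplit : (∑ u, ∑ v, if A u v then w u v else 0)
      = (∑ u, ∑ v, if A u v ∧ (m u ≠ u ∨ m v ≠ v) then w u v else 0)
        + ∑ u, ∑ v, if A u v ∧ m u = u ∧ m v = v then w u v else 0 := by
    simp only [← sum_add_distrib]
    refine sum_congr rfl fun u _ => sum_congr rfl fun v _ => ?_
    by_cases hA : A u v <;> by_cases hu : m u = u <;> by_cases hv : m v = v <;>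
      simp [hA, hu, hv]
  set Z := ∑ u, ∑ v, if A u v ∧ m u = u ∧ m v = v then w u v else 0 with hZ
  -- At most n² pairs are untouched, each of weight at most W/(2i).
  have h1 : 2 * i * Z ≤ n * (n * W) := by
    have hb : ∀ u v, 2 * i * (if A u v ∧ m u = u ∧ m v = v then w u v else 0) ≤ W := by
      intro u v
      split_ifs with hc
      · exact h.heavy u v hc.1 hc.2.1 hc.2.2
      · simp
    rw [hZ]
    simp only [mul_sum]
    refine (sum_le_sum fun u _ => sum_le_sum fun v _ => hb u v).trans ?_
    simp [hn]
  have h2 : Z ≤ 16 * n * W := by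
    rcases Nat.eq_zero_or_pos n with h0 | hpos
    · have : IsEmpty V := Fintype.card_eq_zero_iff.1 h0
      simp [hZ]
    · refine Nat.le_of_mul_le_mul_left ?_ hpos
      calc n * Z ≤ 32 * i * Z := Nat.mul_le_mul_right _ hV
        _ = 16 * (2 * i * Z) := by ring
        _ ≤ 16 * (n * (n * W)) := Nat.mul_le_mul_left _ h1
        _ = n * (16 * n * W) := by ring
  have h3 : _ ≤ 2 * n * W := h.touched
  rw [hsplit]
  linarith

/-- An involution of a set of even size with at most one fixed point has none. -/
theorem ne_of_fixed_unique {m : V → V} (hm : Function.Involutive m)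
    (heven : Even (Fintype.card V)) (huniq : ∀ u v, m u = u → m v = v → u = v) (u : V) :
    m u ≠ u := by
  intro hu
  -- The number of fixed points of an involution has the parity of the set.
  have h2 := Equiv.Perm.card_fixedPoints_modEq (α := V) (f := m) (p := 2) (n := 1)
    (by rw [pow_one]; exact (pow_two (M := Function.End V) m).trans (funext hm))
  have h1 : Fintype.card (Function.fixedPoints m) = 1 := by
    rw [Fintype.card_eq_one_iff]
    exact ⟨⟨u, hu⟩, fun v => Subtype.ext (huniq _ _ v.2 hu)⟩
  rw [h1] at h2
  obtain ⟨k, hk⟩ := heven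
  rw [hk] at h2
  have : (k + k) % 2 = 1 % 2 := h2
  omega

end PartialMatching

/-! ### Programs with counting loops -/

/-- Programs whose only loops are counting loops: `loop x b c` runs `c` with the values
`0, 1, …, N - 1` of the register `x`, where `N` is the value of the register `b`. The register `x`
is the cell `(0, 0)` of the array `x`. -/
inductive Code : Type
  | skip : Code
  | assign (a : ℕ) (i j e : Expr) : Code
  | seq (c d : Code) : Code
  | ite (e : Expr) (c d : Code) : Code
  | loop (x b : ℕ) (c : Code) : Code

/-- The expression reading a register. -/
abbrev reg (x : ℕ) : Expr := .cell x (.const 0) (.const 0)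

namespace Code

/-- The underlying program. -/
def toProg : Code → Prog
  | skip => .skip
  | assign a i j e => .assign a i j e
  | seq c d => .seq c.toProg d.toProg
  | ite e c d => .ite e c.toProg d.toProg
  | loop x b c => .seq (.assign x (.const 0) (.const 0) (.const 0))
      (.while (.sub (reg b) (reg x))
        (.seq c.toProg (.assign x (.const 0) (.const 0) (.add (reg x) (.const 1)))))

/-- The memory after the execution. -/
def run : Code → Mem → Mem
  | skip, s => s
  | assign a i j e, s => s.write a (i.eval s) (j.eval s) (e.eval s)
  | seq c d, s => d.run (c.run s)
  | ite e c d, s => if e.eval s ≠ 0 then c.run s else d.run s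
  | loop x b c, s =>
      Nat.rec (s.write x 0 0 0) (fun k s => (c.run s).write x 0 0 (k + 1)) (s b 0 0)

/-- The arrays that the program writes to. -/
def writes : Code → List ℕ
  | skip => []
  | assign a _ _ _ => [a]
  | seq c d => c.writes ++ d.writes
  | ite _ c d => c.writes ++ d.writes
  | loop x _ c => x :: c.writes

/-- The registers that hold the lengths of the loops. -/
def bounds : Code → List ℕ
  | skip => []
  | assign _ _ _ _ => []
  | seq c d => c.bounds ++ d.bounds
  | ite _ c d => c.bounds ++ d.bounds
  | loop _ b c => b :: c.bounds

/-- The body of a loop changes neither its counter nor its length. -/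
def WellFormed : Code → Prop
  | skip => True
  | assign _ _ _ _ => True
  | seq c d => c.WellFormed ∧ d.WellFormed
  | ite _ c d => c.WellFormed ∧ d.WellFormed
  | loop x b c => x ∉ c.writes ∧ b ∉ c.writes ∧ x ≠ b ∧ c.WellFormed

/-- A bound on the running time, in terms of a bound on the lengths of the loops. -/
noncomputable def time : Code → Polynomial ℕ
  | skip => 1
  | assign _ i j e => Polynomial.C (i.cost + j.cost + e.cost + 1)
  | seq c d => c.time + d.time
  | ite e c d => Polynomial.C (e.cost + 1) + c.time + d.time
  | loop _ _ c => Polynomial.X * (c.time + Polynomial.C 16) + Polynomial.C 12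

end Code

/-! ### Loop invariants and running time of counting programs -/

theorem Mem.write_of_ne {s : Mem} {a a' i j v : ℕ} (h : a' ≠ a) : s.write a i j v a' = s a' := by
  funext i' j'
  simp [Mem.write, h]

@[simp] theorem Mem.write_self (s : Mem) (a i j v : ℕ) : s.write a i j v a i j = v := by
  simp [Mem.write]

theorem Mem.write_same (s : Mem) (a i j v i' j' : ℕ) :
    s.write a i j v a i' j' = if i' = i ∧ j' = j then v else s a i' j' := by
  simp [Mem.write]

namespace Code

theorem run_frame (c : Code) {a : ℕ} (h : a ∉ c.writes) (s : Mem) : c.run s a = s a := by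
  induction c generalizing s with
  | skip => rfl
  | assign b i j e => exact Mem.write_of_ne (by simpa [writes] using h)
  | seq c d ihc ihd =>
    simp only [writes, List.mem_append, not_or] at h
    rw [run, ihd h.2, ihc h.1]
  | ite e c d ihc ihd =>
    simp only [writes, List.mem_append, not_or] at h
    rw [run]
    split_ifs
    · exact ihc h.1 s
    · exact ihd h.2 s
  | loop x b c ih =>
    simp only [writes, List.mem_cons, not_or] at h
    rw [run]
    generalize s b 0 0 = N
    induction N with
    | zero => exact Mem.write_of_ne h.1
    | succ k ihk => exact (Mem.write_of_ne h.1).trans ((ih h.2 _).trans ihk)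

theorem run_ite_of_ne {e : Expr} {c d : Code} {s : Mem} (h : e.eval s ≠ 0) :
    (ite e c d).run s = c.run s := if_pos h

theorem run_ite_of_not_ne {e : Expr} {c d : Code} {s : Mem} (h : ¬ e.eval s ≠ 0) :
    (ite e c d).run s = d.run s := if_neg h

/-- Induction along a loop. -/
theorem run_loop {x b : ℕ} {c : Code} (I : ℕ → Mem → Prop) {s : Mem}
    (hw : ∀ k s v, I k s → I k (s.write x 0 0 v)) (h0 : I 0 s)
    (hstep : ∀ k s', k < s b 0 0 → s' x 0 0 = k → (∀ a, a ∉ x :: c.writes → s' a = s a) →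
      I k s' → I (k + 1) (c.run s')) :
    I (s b 0 0) ((loop x b c).run s) := by
  rw [run]
  set st : ℕ → Mem := fun k => Nat.rec (s.write x 0 0 0)
    (fun k s => (c.run s).write x 0 0 (k + 1)) k with hst
  have key : ∀ N ≤ s b 0 0, I N (st N) ∧ st N x 0 0 = N ∧
      ∀ a, a ∉ x :: c.writes → st N a = s a := by
    intro N hN
    induction N with
    | zero =>
      refine ⟨hw 0 s 0 h0, Mem.write_self .., fun a ha => Mem.write_of_ne ?_⟩
      exact (not_or.1 (List.mem_cons.not.1 ha)).1
    | succ k ih =>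
      obtain ⟨h1, h2, h3⟩ := ih (by omega)
      refine ⟨hw _ _ _ (hstep k _ (by omega) h2 h3 h1), Mem.write_self .., fun a ha => ?_⟩
      have ha' := not_or.1 (List.mem_cons.not.1 ha)
      exact (Mem.write_of_ne ha'.1).trans ((run_frame c ha'.2 _).trans (h3 a ha))
  exact (key _ le_rfl).1

/-- Induction along two nested loops. -/
theorem run_loop_loop {x y b : ℕ} {c : Code} (I : ℕ → ℕ → Mem → Prop) {s : Mem} {N : ℕ}
    (hN : s b 0 0 = N) (hx : x ∉ y :: c.writes) (hb : b ∉ x :: y :: c.writes)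
    (hwx : ∀ k j s v, I k j s → I k j (s.write x 0 0 v))
    (hwy : ∀ k j s v, I k j s → I k j (s.write y 0 0 v)) (h0 : I 0 0 s)
    (hnext : ∀ k s, I k N s → I (k + 1) 0 s)
    (hstep : ∀ k j s', k < N → j < N → s' x 0 0 = k → s' y 0 0 = j →
      (∀ a, a ∉ x :: y :: c.writes → s' a = s a) → I k j s' → I k (j + 1) (c.run s')) :
    I N 0 ((loop x b (loop y b c)).run s) := by
  subst hN
  refine run_loop (fun k => I k 0) (fun k => hwx k 0) h0 fun k s₁ hk hs₁ hf₁ h₁ => hnext k _ ?_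
  -- The length register is untouched, so the inner loop makes N passes each time.
  have hb₁ : s₁ b 0 0 = s b 0 0 := by rw [hf₁ b hb]
  have := run_loop (x := y) (b := b) (c := c) (s := s₁) (I k) (hwy k) h₁
    fun j s₂ hj hs₂ hf₂ h₂ => hstep k j s₂ hk (hb₁ ▸ hj) ?_ hs₂ (fun a ha => ?_) h₂
  · rwa [hb₁] at this
  · rw [hf₂ x hx, hs₁]
  · rw [hf₂ a fun h => ha (List.mem_cons_of_mem _ h), hf₁ a ha]

/-- A length register that the code never writes keeps its initial value, so one bound `N` on the
initial values controls all loops. -/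
theorem exec (c : Code) (hc : c.WellFormed) (s : Mem) : ∃ t, Exec c.toProg s (c.run s) t ∧
    ∀ N, (∀ b ∈ c.bounds, b ∉ c.writes ∧ s b 0 0 ≤ N) → t ≤ c.time.eval N := by
  induction c generalizing s with
  | skip => exact ⟨1, .skip s, fun N _ => by simp [time]⟩
  | assign a i j e => exact ⟨_, .assign a i j e s, fun N _ => by simp [time]⟩
  | seq c d ihc ihd =>
    obtain ⟨t, ht, htime⟩ := ihc hc.1 s
    obtain ⟨t', ht', htime'⟩ := ihd hc.2 (c.run s)
    refine ⟨t + t', .seq ht ht', fun N hN => ?_⟩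
    simp only [bounds, writes, List.mem_append, not_or] at hN
    rw [time, Polynomial.eval_add]
    refine add_le_add (htime N fun b hb => ?_) (htime' N fun b hb => ?_)
    · exact ⟨(hN b (Or.inl hb)).1.1, (hN b (Or.inl hb)).2⟩
    · obtain ⟨⟨h1, h2⟩, h3⟩ := hN b (Or.inr hb)
      exact ⟨h2, by rwa [run_frame c h1]⟩
  | ite e c d ihc ihd =>
    by_cases he : e.eval s = 0
    · obtain ⟨t, ht, htime⟩ := ihd hc.2 s
      refine ⟨e.cost + 1 + t, ?_, fun N hN => ?_⟩
      · rw [run, if_neg (by simpa using he)]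
        exact .ite_false he ht
      · simp only [bounds, writes, List.mem_append, not_or] at hN
        have := htime N fun b hb => ⟨(hN b (Or.inr hb)).1.2, (hN b (Or.inr hb)).2⟩
        simp only [time, Polynomial.eval_add, Polynomial.eval_C]
        omega
    · obtain ⟨t, ht, htime⟩ := ihc hc.1 s
      refine ⟨e.cost + 1 + t, ?_, fun N hN => ?_⟩
      · rw [run, if_pos he]
        exact .ite_true he ht
      · simp only [bounds, writes, List.mem_append, not_or] at hN
        have := htime N fun b hb => ⟨(hN b (Or.inl hb)).1.1, (hN b (Or.inl hb)).2⟩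
        simp only [time, Polynomial.eval_add, Polynomial.eval_C]
        omega
  | loop x b c ih =>
    obtain ⟨hx, hb, hxb, hwf⟩ := hc
    set L := s b 0 0 with hL
    set st : ℕ → Mem := fun k => Nat.rec (s.write x 0 0 0)
      (fun k s => (c.run s).write x 0 0 (k + 1)) k with hst
    have hsucc : ∀ k, st (k + 1) = (c.run (st k)).write x 0 0 (k + 1) := fun _ => rfl
    have hframe : ∀ k a, a ≠ x → a ∉ c.writes → st k a = s a := by
      intro k a hax hac
      induction k with
      | zero => exact Mem.write_of_ne hax
      | succ k ihk => rw [hsucc, Mem.write_of_ne hax, run_frame c hac, ihk]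
    have hctr : ∀ k, st k x 0 0 = k := by
      intro k
      cases k with
      | zero => exact Mem.write_self ..
      | succ k => rw [hsucc, Mem.write_self]
    -- Induction on the number `j` of passes left. A pass costs the body plus 8 steps for the test
    -- and 8 for the counter; the failing test costs 8 and the initial assignment 4. These are the
    -- constants 16 and 12 in `time`.
    have hloop : ∀ j k, k + j = L → ∃ t, Exec (.while (.sub (reg b) (reg x))
        (.seq c.toProg (.assign x (.const 0) (.const 0) (.add (reg x) (.const 1)))))
          (st k) (st L) t ∧ ∀ N, (∀ b' ∈ b :: c.bounds, b' ∉ x :: c.writes ∧ s b' 0 0 ≤ N) →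
            t ≤ j * (c.time.eval N + 16) + 8 := by
      intro j
      induction j with
      | zero =>
        rintro k rfl
        refine ⟨_, .while_false ?_, fun N _ => ?_⟩
        · simp only [Expr.eval]
          rw [hctr, hframe _ b hxb.symm hb, ← hL]
          simp
        · simp [Expr.cost]
      | succ j ihj =>
        intro k hk
        obtain ⟨t, ht, htime⟩ := ih hwf (st k)
        obtain ⟨t', ht', htime'⟩ := ihj (k + 1) (by omega)
        have hassign : Exec (.assign x (.const 0) (.const 0) (.add (reg x) (.const 1)))
            (c.run (st k)) (st (k + 1)) 8 := by
          have := Exec.assign x (.const 0) (.const 0) (.add (reg x) (.const 1)) (c.run (st k))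
          simp only [Expr.eval] at this
          rwa [run_frame c hx, hctr] at this
        refine ⟨_, .while_true ?_ (.seq ht hassign) ht', fun N hN => ?_⟩
        · simp only [Expr.eval]
          rw [hctr, hframe _ b hxb.symm hb, ← hL]
          omega
        · have h1 := htime' N hN
          have h2 := htime N fun b' hb' => by
            obtain ⟨h3, h4⟩ := hN b' (List.mem_cons_of_mem _ hb')
            simp only [List.mem_cons, not_or] at h3
            exact ⟨h3.2, by rwa [hframe k b' h3.1 h3.2]⟩
          simp only [Expr.cost]
          linarith
    obtain ⟨t, ht, htime⟩ := hloop L 0 (by omega)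
    refine ⟨_, .seq (.assign _ _ _ _ _) ht, fun N hN => ?_⟩
    have h1 := htime N hN
    have h2 : L ≤ N := (hN b List.mem_cons_self).2
    have h3 := Nat.mul_le_mul_right (c.time.eval N + 16) h2
    simp only [Expr.cost, time, Polynomial.eval_add, Polynomial.eval_mul, Polynomial.eval_X,
      Polynomial.eval_C]
    omega

end Code

/-! ### The algorithm

The array `4` holds the Gram matrix, `6` the partners in the current matching (column `0`), and `7`
marks the vertices of the heavy edges (column `0`). -/

section Algorithm

open Code

/-- Conjunction of tests. -/
def Expr.and (e f : Expr) : Expr :=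
  .sub (.const 1) (.add (.sub (.const 1) e) (.sub (.const 1) f))

/-- Test for equality. -/
def Expr.eq (e f : Expr) : Expr :=
  .sub (.const 1) (.add (.sub e f) (.sub f e))

theorem Expr.eval_and (s : Mem) (e f : Expr) :
    (Expr.and e f).eval s ≠ 0 ↔ e.eval s ≠ 0 ∧ f.eval s ≠ 0 := by
  simp only [Expr.and, Expr.eval]
  omega

theorem Expr.eval_eq (s : Mem) (e f : Expr) : (Expr.eq e f).eval s ≠ 0 ↔ e.eval s = f.eval s := by
  simp only [Expr.eq, Expr.eval]
  omega

/-- Assignment to a register. -/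
abbrev setReg (x : ℕ) (e : Expr) : Code := .assign x (.const 0) (.const 0) e

/-- The partner of a vertex. -/
abbrev mateExpr (u : Expr) : Expr := .cell 6 u (.const 0)

/-- The test whether a pair is an unused edge. -/
abbrev edgeExpr (u v : Expr) : Expr := .sub (.cell 1 u v) (.cell 3 u v)

/-- The weight of a pair. -/
abbrev weightExpr (u v : Expr) : Expr :=
  .sub (.add (.cell 4 u u) (.cell 4 v v)) (.add (.cell 4 u v) (.cell 4 u v))

/-- The test whether a vertex is unmatched. -/
abbrev freeExpr (u : Expr) : Expr := .eq (mateExpr u) u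

/-- Makes the vertices in two registers partners. -/
def linkCode (x y : ℕ) : Code :=
  .seq (.assign 6 (reg x) (.const 0) (reg y)) (.assign 6 (reg y) (.const 0) (reg x))

/-- Starts with the empty matching. -/
def resetCode : Code :=
  .loop 12 0 (.seq (.assign 6 (reg 12) (.const 0) (reg 12))
    (.assign 7 (reg 12) (.const 0) (.const 0)))

/-- Tests whether a pair is an unused edge between unmatched vertices. -/
def availTest : Expr :=
  .and (edgeExpr (reg 12) (reg 13)) (.and (freeExpr (reg 12)) (freeExpr (reg 13)))

/-- Records an available edge if it is heavier than the previous ones. -/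
def compareCode : Code :=
  .ite (.and availTest (.sub (weightExpr (reg 12) (reg 13)) (reg 15)))
    (.seq (setReg 15 (weightExpr (reg 12) (reg 13)))
      (.seq (setReg 16 (reg 12)) (setReg 17 (reg 13)))) .skip

/-- Finds a heaviest available edge. -/
def searchCode : Code :=
  .seq (setReg 15 (.const 0)) (.loop 12 0 (.loop 13 0 compareCode))

/-- Adds a heaviest unused edge to the matching and marks its vertices. -/
def greedyStepCode : Code :=
  .seq searchCode (.ite (reg 15) (.seq (linkCode 16 17)
    (.seq (.assign 7 (reg 16) (.const 0) (.const 1)) (.assign 7 (reg 17) (.const 0) (.const 1))))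
    .skip)

/-- Twice the value of an expression. -/
abbrev Expr.double (e : Expr) : Expr := .add e e

/-- Chooses `n / 16` heavy edges greedily. -/
def greedyCode : Code :=
  .loop 11 0 (.ite (.sub (.add (reg 0) (.const 1)) (Expr.double (Expr.double (Expr.double
    (Expr.double (.add (reg 11) (.const 1))))))) greedyStepCode .skip)

/-- Extends the matching to a maximal one. -/
def maximalCode : Code :=
  .loop 12 0 (.loop 13 0 (.ite availTest (linkCode 12 13) .skip))

/-- Negation of a test. -/
def Expr.not (e : Expr) : Expr := .sub (.const 1) e

theorem Expr.eval_not (s : Mem) (e : Expr) : (Expr.not e).eval s ≠ 0 ↔ ¬ e.eval s ≠ 0 := by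
  simp only [Expr.not, Expr.eval]
  omega

/-- Tests for an augmenting path with three edges that avoids the marked vertices. -/
def augmentTest : Expr :=
  .and (.and (freeExpr (reg 12)) (freeExpr (reg 13))) (.and (.not (.eq (reg 12) (reg 13)))
    (.and (.not (.cell 7 (reg 14) (.const 0))) (.and (.not (freeExpr (reg 14)))
      (.and (edgeExpr (reg 12) (reg 14)) (edgeExpr (reg 13) (mateExpr (reg 14)))))))

/-- Augments along a path with three edges. -/
def augmentStepCode : Code :=
  .ite augmentTest (.seq (setReg 18 (mateExpr (reg 14)))
    (.seq (linkCode 12 14) (linkCode 13 18))) .skip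

/-- Extends the matching by augmenting paths with three edges that avoid the marked vertices. -/
def augmentCode : Code := .loop 12 0 (.loop 13 0 (.loop 14 0 augmentStepCode))

/-- Adds the matching to the output. -/
def recordCode : Code :=
  .loop 12 0 (.assign 3 (reg 12) (mateExpr (reg 12)) (.const 1))

/-- Updates the Gram matrix. -/
def gramCode : Code :=
  .seq (.loop 12 0 (.loop 13 0 (.assign 5 (reg 12) (reg 13)
    (.add (.add (.add (.cell 4 (reg 12) (reg 13)) (.cell 4 (reg 12) (mateExpr (reg 13))))
      (.cell 4 (mateExpr (reg 12)) (reg 13)))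
      (.cell 4 (mateExpr (reg 12)) (mateExpr (reg 13)))))))
    (.loop 12 0 (.loop 13 0 (.assign 4 (reg 12) (reg 13) (.cell 5 (reg 12) (reg 13)))))

/-- One round: finds a perfect matching of unused edges and adds it to the output. -/
def roundCode : Code :=
  .seq resetCode (.seq greedyCode (.seq maximalCode (.seq augmentCode (.seq recordCode gramCode))))

/-- Computes the number of rounds by repeated doubling. -/
def countCode : Code :=
  .loop 11 0 (.ite (.sub (reg 0) (reg 9)) (.seq (setReg 9 (.add (reg 9) (reg 9)))
    (setReg 8 (.add (reg 8) (.const 216)))) .skip)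

/-- Computes the first Gram matrix. -/
def unitCode : Code := .loop 12 0 (.assign 4 (reg 12) (reg 12) (.const 1))

/-- The computations before the first round. -/
def prepareCode : Code := .seq (setReg 9 (.const 1)) (.seq countCode unitCode)

/-- All rounds. -/
def roundsCode : Code := .loop 10 8 roundCode

/-! ### Correctness of the greedy and the maximal matching -/

variable {n : ℕ}

/-- The unused edges are those of `A`. -/
def EdgesAre (A : Fin n → Fin n → Prop) (s : Mem) : Prop :=
  ∀ u v : Fin n, s 1 u v - s 3 u v ≠ 0 ↔ A u v

/-- The partners are given by `m`. -/
def MateIs (m : Fin n → Fin n) (s : Mem) : Prop := ∀ u : Fin n, s 6 u 0 = m u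

/-- The weights are given by `w`. -/
def WeightsAre (w : Fin n → Fin n → ℕ) (s : Mem) : Prop :=
  ∀ u v : Fin n, s 4 u u + s 4 v v - (s 4 u v + s 4 u v) = w u v

/-- The marked vertices are those in `R`. -/
def MarkedAre (R : Finset (Fin n)) (s : Mem) : Prop := ∀ u : Fin n, s 7 u 0 ≠ 0 ↔ u ∈ R

variable {A : Fin n → Fin n → Prop} {m : Fin n → Fin n} {s : Mem}

theorem MateIs.of_eq {s' : Mem} (h : MateIs m s) (hs : s' 6 = s 6) : MateIs m s' := by
  intro u
  rw [hs, h u]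

theorem EdgesAre.of_eq {s' : Mem} (h : EdgesAre A s) (h1 : s' 1 = s 1) (h3 : s' 3 = s 3) :
    EdgesAre A s' := by
  intro u v
  rw [h1, h3, h u v]

theorem WeightsAre.of_eq {w : Fin n → Fin n → ℕ} {s' : Mem} (h : WeightsAre w s)
    (h4 : s' 4 = s 4) : WeightsAre w s' := by
  intro u v
  rw [h4, h u v]

theorem MarkedAre.of_eq {R : Finset (Fin n)} {s' : Mem} (h : MarkedAre R s)
    (h7 : s' 7 = s 7) : MarkedAre R s' := by
  intro u
  rw [h7, h u]

theorem MateIs.link (h : MateIs m s) {x y : ℕ} (hx : x ≠ 6) (hy : y ≠ 6) {a b : Fin n}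
    (ha : s x 0 0 = a) (hb : s y 0 0 = b) : MateIs (link m a b) ((linkCode x y).run s) := by
  intro u
  simp only [linkCode, run, Expr.eval, Mem.write_of_ne hx, Mem.write_of_ne hy, Mem.write_same,
    ha, hb, link_apply, and_true, h u, Fin.val_inj]
  split_ifs <;> rfl

theorem resetCode_spec (hn : s 0 0 0 = n) :
    MateIs (id : Fin n → Fin n) (resetCode.run s) ∧ MarkedAre (∅ : Finset (Fin n)) (resetCode.run s)
    := by
  have h := run_loop (x := 12) (b := 0) (c := .seq (.assign 6 (reg 12) (.const 0) (reg 12))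
    (.assign 7 (reg 12) (.const 0) (.const 0)))
    (fun k s => ∀ u : ℕ, u < k → s 6 u 0 = u ∧ s 7 u 0 = 0) (s := s)
    (by intro k s v h; simpa [Mem.write_of_ne] using h) (by simp) (by
      intro k s' hk hx hf h u hu
      have := h u
      simp only [run, Expr.eval, hx, Mem.write_of_ne, Mem.write_same, ne_eq, and_true,
        Nat.reduceEqDiff, not_false_eq_true]
      split_ifs
      · omega
      · exact this (by omega))
  rw [hn] at h
  refine ⟨fun u => (h u u.2).1, fun u => ?_⟩
  simp [resetCode, (h u u.2).2]

theorem availTest_eval (hA : EdgesAre A s) (hm : MateIs m s) {u v : Fin n} (hu : s 12 0 0 = u)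
    (hv : s 13 0 0 = v) : availTest.eval s ≠ 0 ↔ A u v ∧ m u = u ∧ m v = v := by
  simp only [availTest, Expr.eval_and, Expr.eval_eq]
  simp only [Expr.eval, hu, hv, hm u, hm v, hA u v, Fin.val_inj]

/-- Register 15 holds the best weight so far. Only strict improvements are recorded, so a final 0
means that no available edge has positive weight. -/
theorem searchCode_spec {w : Fin n → Fin n → ℕ} (hn : s 0 0 0 = n) (hA : EdgesAre A s)
    (hm : MateIs m s) (hw : WeightsAre w s) :
    (∀ u v, A u v → m u = u → m v = v → w u v ≤ searchCode.run s 15 0 0) ∧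
    (searchCode.run s 15 0 0 ≠ 0 → ∃ a b : Fin n, A a b ∧ m a = a ∧ m b = b ∧
      w a b = searchCode.run s 15 0 0 ∧ searchCode.run s 16 0 0 = a ∧
      searchCode.run s 17 0 0 = b) := by
  have h := run_loop_loop (x := 12) (y := 13) (b := 0) (N := n) (c := compareCode)
    (fun k j s => (∀ u v : Fin n, (u < k ∨ u = k ∧ v < j) → A u v → m u = u → m v = v →
        w u v ≤ s 15 0 0) ∧
      (s 15 0 0 ≠ 0 → ∃ a b : Fin n, A a b ∧ m a = a ∧ m b = b ∧
      w a b = s 15 0 0 ∧ s 16 0 0 = a ∧ s 17 0 0 = b))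
    (s := (setReg 15 (.const 0)).run s) (by simpa [run, Mem.write_of_ne] using hn)
    (by decide) (by decide)
    (by intro k j s v h; simpa [Mem.write_of_ne] using h)
    (by intro k j s v h; simpa [Mem.write_of_ne] using h)
    (by simp [run, Expr.eval])
    (by
      rintro k s ⟨h1, h2⟩
      refine ⟨fun u v huv => h1 u v ?_, h2⟩
      have := v.2
      omega)
    (by
      rintro k j s' hk hj hx hy hf ⟨h1, h2⟩
      have hA' : EdgesAre A s' := hA.of_eq
        ((hf 1 (by decide)).trans (by simp [run, Mem.write_of_ne]))
        ((hf 3 (by decide)).trans (by simp [run, Mem.write_of_ne]))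
      have hm' : MateIs m s' := hm.of_eq
        ((hf 6 (by decide)).trans (by simp [run, Mem.write_of_ne]))
      have hw' : WeightsAre w s' := hw.of_eq
        ((hf 4 (by decide)).trans (by simp [run, Mem.write_of_ne]))
      lift k to Fin n using hk
      lift j to Fin n using hj
      have htest : (Expr.and availTest (.sub (weightExpr (reg 12) (reg 13)) (reg 15))).eval s' ≠ 0
          ↔ (A k j ∧ m k = k ∧ m j = j) ∧ s' 15 0 0 < w k j := by
        rw [Expr.eval_and, availTest_eval hA' hm' hx hy]
        simp only [Expr.eval, hx, hy, hw' k j, Nat.sub_ne_zero_iff_lt]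
      have hdone : ∀ u v : Fin n, (u < (k : ℕ) ∨ u = (k : ℕ) ∧ v < (j : ℕ) + 1) →
          (u < (k : ℕ) ∨ u = (k : ℕ) ∧ v < (j : ℕ)) ∨ (u = k ∧ v = j) := by
        intro u v huv
        simp only [Fin.ext_iff]
        omega
      by_cases hc : (A k j ∧ m k = k ∧ m j = j) ∧ s' 15 0 0 < w k j
      · rw [compareCode, run_ite_of_ne (htest.2 hc)]
        simp only [run, Expr.eval, Mem.write_of_ne, Mem.write_self, ne_eq, Nat.reduceEqDiff,
          not_false_eq_true, hx, hy, hw' k j]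
        refine ⟨fun u v huv hAuv hu hv => ?_, fun _ =>
          ⟨k, j, hc.1.1, hc.1.2.1, hc.1.2.2, rfl, rfl, rfl⟩⟩
        rcases hdone u v huv with h | ⟨rfl, rfl⟩
        · have := h1 u v h hAuv hu hv
          omega
        · exact le_rfl
      · rw [compareCode, run_ite_of_not_ne (htest.not.2 hc)]
        refine ⟨fun u v huv hAuv hu hv => ?_, h2⟩
        rcases hdone u v huv with h | ⟨rfl, rfl⟩
        · exact h1 u v h hAuv hu hv
        · exact not_lt.1 fun hlt => hc ⟨⟨hAuv, hu, hv⟩, hlt⟩)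
  exact ⟨fun u v => h.1 u v (Or.inl u.2), h.2⟩

/-- The greedy part has built a matching with the greedy invariant and marked its vertices. -/
def GreedyState (A : Fin n → Fin n → Prop) [DecidableRel A] (w : Fin n → Fin n → ℕ) (i : ℕ)
    (s : Mem) : Prop :=
  ∃ m : Fin n → Fin n, MateIs m s ∧ MarkedAre {u | m u ≠ u} s ∧ GreedyInv A w i m

theorem greedyStepCode_spec [DecidableRel A] {w : Fin n → Fin n → ℕ} {i : ℕ} (hn : s 0 0 0 = n)
    (hA : EdgesAre A s) (hw : WeightsAre w s) (hs : ∀ u v, A u v → A v u) (hi : ∀ u, ¬ A u u)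
    (hw0 : ∀ u, w u u = 0) (hws : ∀ u v, w u v = w v u) (h : GreedyState A w i s) :
    GreedyState A w (i + 1) (greedyStepCode.run s) := by
  obtain ⟨m, hm, hR, hinv⟩ := h
  obtain ⟨h1, h2⟩ := searchCode_spec hn hA hm hw
  have hm' : MateIs m (searchCode.run s) := hm.of_eq (run_frame _ (by decide) s)
  have hR' := hR.of_eq (run_frame searchCode (by decide) s)
  rw [greedyStepCode, run]
  by_cases hc : (reg 15).eval (searchCode.run s) ≠ 0
  · rw [run_ite_of_ne hc]
    obtain ⟨a, b, hab, ha, hb, hwab, h16, h17⟩ := h2 hc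
    have hne : a ≠ b := by rintro rfl; exact hi a hab
    refine ⟨link m a b, (hm'.link (by decide) (by decide) h16 h17).of_eq ?_, fun u => ?_,
      hinv.link hs hi hw0 hws hab ha hb (by rwa [hwab])⟩
    · simp [run, Mem.write_of_ne]
    · have := hR' u
      simp only [linkCode, run, Expr.eval, Mem.write_of_ne, Mem.write_same, ne_eq,
        Nat.reduceEqDiff, not_false_eq_true, h16, h17, and_true, Fin.val_inj, Finset.mem_filter,
        Finset.mem_univ, true_and, link_apply] at this ⊢
      grind
  · rw [run_ite_of_not_ne hc]
    refine ⟨m, hm', hR', hinv.succ_of_weight_eq_zero fun u v huv hu hv => ?_⟩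
    have := h1 u v huv hu hv
    simp only [Expr.eval, ne_eq, not_not] at hc
    omega

theorem greedyCode_spec [DecidableRel A] {w : Fin n → Fin n → ℕ} (hn : s 0 0 0 = n)
    (hA : EdgesAre A s) (hw : WeightsAre w s) (hs : ∀ u v, A u v → A v u) (hi : ∀ u, ¬ A u u)
    (hw0 : ∀ u, w u u = 0) (hws : ∀ u v, w u v = w v u) (hm : MateIs (id : Fin n → Fin n) s)
    (hR : MarkedAre (∅ : Finset (Fin n)) s) : GreedyState A w (n / 16) (greedyCode.run s) := by
  have h := run_loop (x := 11) (b := 0) (c := .ite (.sub (.add (reg 0) (.const 1))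
      (Expr.double (Expr.double (Expr.double (Expr.double (.add (reg 11) (.const 1)))))))
      greedyStepCode .skip) (fun k => GreedyState A w (min k (n / 16))) (s := s)
    (by
      rintro k s v ⟨m, h1, h2, h3⟩
      exact ⟨m, h1.of_eq (Mem.write_of_ne (by decide)), h2.of_eq (Mem.write_of_ne (by decide)), h3⟩)
    ⟨id, hm, by simpa using hR, by simpa using greedyInv_zero A w⟩
    (by
      intro k s' hk hx hf h
      have hn' : s' 0 0 0 = n := by rw [hf 0 (by decide), hn]
      -- The test n + 1 − 16(k + 1) is nonzero exactly in this case, so only the first n/16 of the n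
      -- passes act.
      by_cases hc : 16 * (k + 1) ≤ n
      · rw [run_ite_of_ne (by simp only [Expr.eval, hx, hn']; omega),
          show min (k + 1) (n / 16) = min k (n / 16) + 1 by omega]
        exact greedyStepCode_spec hn' (hA.of_eq (hf 1 (by decide)) (hf 3 (by decide)))
          (hw.of_eq (hf 4 (by decide))) hs hi hw0 hws h
      · rw [run_ite_of_not_ne (by simp only [Expr.eval, hx, hn']; omega),
          show min (k + 1) (n / 16) = min k (n / 16) by omega]
        exact h)
  rwa [hn, min_eq_right (Nat.div_le_self _ _)] at h

/-- A matching of `A` that extends `m₀`. -/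
def IsExtension (A : Fin n → Fin n → Prop) (m₀ m : Fin n → Fin n) : Prop :=
  IsPartialMatching A m ∧ ∀ u, m₀ u ≠ u → m u = m₀ u

/-- Free vertices only disappear, so a pair that has been ruled out stays ruled out and one pass
over all pairs suffices. -/
theorem maximalCode_spec {m₀ : Fin n → Fin n} (hn : s 0 0 0 = n) (hA : EdgesAre A s)
    (hs : ∀ u v, A u v → A v u) (hi : ∀ u, ¬ A u u) (hm : MateIs m₀ s)
    (hpm : IsPartialMatching A m₀) :
    ∃ m, MateIs m (maximalCode.run s) ∧ IsExtension A m₀ m ∧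
      ∀ u v, m u = u → m v = v → ¬ A u v := by
  have h := run_loop_loop (x := 12) (y := 13) (b := 0) (N := n)
    (c := .ite availTest (linkCode 12 13) .skip)
    (fun k j s => ∃ m, MateIs m s ∧ IsExtension A m₀ m ∧
      ∀ u v : Fin n, (u < k ∨ u = k ∧ v < j) → m u = u → m v = v → ¬ A u v)
    (s := s) hn (by decide) (by decide)
    (by
      rintro k j s v ⟨m, h1, h2⟩
      exact ⟨m, h1.of_eq (Mem.write_of_ne (by decide)), h2⟩)
    (by
      rintro k j s v ⟨m, h1, h2⟩
      exact ⟨m, h1.of_eq (Mem.write_of_ne (by decide)), h2⟩)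
    ⟨m₀, hm, ⟨hpm, fun _ _ => rfl⟩, by simp⟩
    (by
      rintro k s ⟨m, h1, h2, h3⟩
      refine ⟨m, h1, h2, fun u v huv => h3 u v ?_⟩
      have := v.2
      omega)
    (by
      rintro k j s' hk hj hx hy hf ⟨m, h1, h2, h3⟩
      have hA' : EdgesAre A s' := hA.of_eq (hf 1 (by decide)) (hf 3 (by decide))
      lift k to Fin n using hk
      lift j to Fin n using hj
      have htest := availTest_eval hA' h1 hx hy
      have hdone : ∀ u v : Fin n, (u < (k : ℕ) ∨ u = (k : ℕ) ∧ v < (j : ℕ) + 1) →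
          (u < (k : ℕ) ∨ u = (k : ℕ) ∧ v < (j : ℕ)) ∨ (u = k ∧ v = j) := by
        intro u v huv
        simp only [Fin.ext_iff]
        omega
      by_cases hc : A k j ∧ m k = k ∧ m j = j
      · rw [run_ite_of_ne (htest.2 hc)]
        obtain ⟨c1, c2, c3⟩ := hc
        have hne : k ≠ j := by rintro rfl; exact hi k c1
        refine ⟨link m k j, h1.link (by decide) (by decide) hx hy,
          ⟨h2.1.link hs c2 c3 c1, fun u hu => ?_⟩, fun u v huv hu hv => ?_⟩
        · have := h2.2 u hu
          rw [link_apply]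
          grind
        · rcases hdone u v huv with h | ⟨rfl, rfl⟩
          · refine h3 u v h ?_ ?_
            · rw [link_apply] at hu
              grind
            · rw [link_apply] at hv
              grind
          · rw [link_apply] at hu
            grind
      · rw [run_ite_of_not_ne (htest.not.2 hc)]
        refine ⟨m, h1, h2, fun u v huv hu hv => ?_⟩
        rcases hdone u v huv with h | ⟨rfl, rfl⟩
        · exact h3 u v h hu hv
        · exact fun hAuv => hc ⟨hAuv, hu, hv⟩)
  obtain ⟨m, h1, h2, h3⟩ := h
  exact ⟨m, h1, h2, fun u v => h3 u v (Or.inl u.2)⟩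

end Algorithm

/-! ### Correctness of the augmentation, the output and the Gram matrix -/

section Algorithm

open Code

variable {n : ℕ} {A : Fin n → Fin n → Prop} {m : Fin n → Fin n} {s : Mem}

theorem augmentTest_eval {R : Finset (Fin n)} (hA : EdgesAre A s) (hm : MateIs m s)
    (hR : MarkedAre R s) {u v x : Fin n} (hu : s 12 0 0 = u) (hv : s 13 0 0 = v)
    (hx : s 14 0 0 = x) : augmentTest.eval s ≠ 0 ↔
      (m u = u ∧ m v = v) ∧ u ≠ v ∧ x ∉ R ∧ m x ≠ x ∧ A u x ∧ A v (m x) := by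
  simp only [augmentTest, Expr.eval_and, Expr.eval_eq, Expr.eval_not]
  simp only [Expr.eval, hu, hv, hx, hm u, hm v, hm x, hA u x, hA v (m x), hR x, Fin.val_inj, ne_eq]

/-- An augmentation along a path that avoids the marked vertices. -/
theorem augmentStepCode_run (hm : MateIs m s) {u v x : Fin n} (hu : s 12 0 0 = u)
    (hv : s 13 0 0 = v) (hx : s 14 0 0 = x) (htest : augmentTest.eval s ≠ 0) :
    MateIs (link (link m u x) v (m x)) (augmentStepCode.run s) := by
  rw [augmentStepCode, run_ite_of_ne htest, run, run]
  refine (MateIs.link (hm.of_eq ?_) (by decide) (by decide) ?_ ?_).link (by decide) (by decide) ?_ ?_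
  · simp [Mem.write_of_ne]
  · simpa [run, Mem.write_of_ne] using hu
  · simpa [run, Mem.write_of_ne] using hx
  · simpa [run, linkCode, Mem.write_of_ne] using hv
  · simp [run, linkCode, Expr.eval, Mem.write_of_ne, hx, hm x]

/-- Vertices free in `m` remain free in `m₁`, so maximality of `m₁` persists and `exists_augment`
applies at every stage. Hence each pair needs to be visited only once, and at most one vertex stays
free. -/
theorem augmentCode_spec [DecidableRel A] {m₀ m₁ : Fin n → Fin n} (hn : s 0 0 0 = n)
    (hA : EdgesAre A s) (hs : ∀ u v, A u v → A v u)
    (hdeg : ∀ u, 4 * (Finset.card {v | ¬ A u v}) ≤ n)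
    (hm₀ : IsPartialMatching A m₀) (hR : MarkedAre {u | m₀ u ≠ u} s)
    (hcard : 8 * (Finset.card {u | m₀ u ≠ u}) ≤ n) (hm : MateIs m₁ s)
    (hext : IsExtension A m₀ m₁) (hmax : ∀ u v, m₁ u = u → m₁ v = v → ¬ A u v) :
    ∃ m, MateIs m (augmentCode.run s) ∧ IsExtension A m₀ m ∧
      ∀ u v, m u = u → m v = v → u = v := by
  have h := run_loop_loop (x := 12) (y := 13) (b := 0) (N := n)
    (c := .loop 14 0 augmentStepCode)
    (fun k j s => ∃ m, MateIs m s ∧ (IsExtension A m₀ m ∧ ∀ u, m u = u → m₁ u = u) ∧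
      ∀ u v : Fin n, (u < k ∨ u = k ∧ v < j) → m u = u → m v = v → u = v)
    (s := s) hn (by decide) (by decide)
    (by
      rintro k j s v ⟨m, h1, h2⟩
      exact ⟨m, h1.of_eq (Mem.write_of_ne (by decide)), h2⟩)
    (by
      rintro k j s v ⟨m, h1, h2⟩
      exact ⟨m, h1.of_eq (Mem.write_of_ne (by decide)), h2⟩)
    ⟨m₁, hm, ⟨hext, fun _ h => h⟩, by simp⟩
    (by
      rintro k s ⟨m, h1, h2, h3⟩
      refine ⟨m, h1, h2, fun u v huv => h3 u v ?_⟩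
      have := v.2
      omega)
    (by
      rintro k j s' hk hj hx hy hf ⟨m, h1, h2, h3⟩
      lift k to Fin n using hk
      lift j to Fin n using hj
      have hinner := run_loop (x := 14) (b := 0) (c := augmentStepCode) (s := s')
        (fun i s => ∃ m, MateIs m s ∧ (IsExtension A m₀ m ∧ ∀ u, m u = u → m₁ u = u) ∧
          (∀ u v : Fin n, (u < (k : ℕ) ∨ u = (k : ℕ) ∧ v < (j : ℕ)) → m u = u → m v = v → u = v) ∧
          -- No earlier `x` serves the pair while both its vertices are free. Once an augmentation
          -- matches `k`, the clause is vacuous.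
          (m k = k → m j = j → k ≠ j → ∀ x : Fin n, x < i →
            ¬ (m₀ x = x ∧ m x ≠ x ∧ A k x ∧ A j (m x))))
        (by
          rintro i s v ⟨m, h1, h2⟩
          exact ⟨m, h1.of_eq (Mem.write_of_ne (by decide)), h2⟩)
        ⟨m, h1, h2, h3, by simp⟩
        (by
          rintro i t hi hz hft ⟨m, h1, h2, h3, h4⟩
          rw [hf 0 (by decide), hn] at hi
          lift i to Fin n using hi
          have hfs : ∀ a, a ∉ 12 :: 13 :: 14 :: augmentStepCode.writes → t a = s a := fun a ha =>
            (hft a fun h => ha (List.mem_cons_of_mem _ (List.mem_cons_of_mem _ h))).trans (hf a ha)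
          have hA' : EdgesAre A t := hA.of_eq (hfs 1 (by decide)) (hfs 3 (by decide))
          have hR' : MarkedAre {u | m₀ u ≠ u} t := hR.of_eq (hfs 7 (by decide))
          have hx' : t 12 0 0 = k := by rw [hft 12 (by decide), hx]
          have hy' : t 13 0 0 = j := by rw [hft 13 (by decide), hy]
          have htest := augmentTest_eval hA' h1 hR' hx' hy' hz
          simp only [Finset.mem_filter, Finset.mem_univ, true_and, not_not] at htest
          by_cases hc : (m k = k ∧ m j = j) ∧ k ≠ j ∧ m₀ i = i ∧ m i ≠ i ∧ A k i ∧ A j (m i)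
          · have hrun := augmentStepCode_run h1 hx' hy' hz (htest.2 hc)
            obtain ⟨⟨c1, c2⟩, c3, c4, c5, c6, c7⟩ := hc
            obtain ⟨⟨p1, p2⟩, p3⟩ := h2
            have hinv := p1.1
            have hinv₀ := hm₀.1
            have hfix : ∀ u, link (link m k i) j (m i) u = u → m u = u ∧ u ≠ k := by
              intro u
              simp only [link_apply]
              clear h3 h4 htest hft hfs hf
              grind
            refine ⟨_, hrun, ⟨⟨p1.augment hs c1 c2 c3 c5 c6 c7, fun u hu => ?_⟩,
              fun u hu => p3 u (hfix u hu).1⟩,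
              fun u v huv hu hv => h3 u v huv (hfix u hu).1 (hfix v hv).1,
              fun hk => absurd rfl (hfix k hk).2⟩
            have := p2 u hu
            simp only [link_apply]
            clear h3 h4 htest hft hfs hf hfix
            grind
          · rw [augmentStepCode, run_ite_of_not_ne (htest.not.2 hc)]
            refine ⟨m, h1, h2, h3, fun hk hj hkj x hxi hx => ?_⟩
            rcases Nat.lt_succ_iff_lt_or_eq.1 hxi with h | h
            · exact h4 hk hj hkj x h hx
            · obtain rfl := Fin.ext h
              exact hc ⟨⟨hk, hj⟩, hkj, hx⟩)
      obtain ⟨m, h1, h2, h3, h4⟩ := hinner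
      rw [hf 0 (by decide), hn] at h4
      refine ⟨m, h1, h2, fun u v huv hu hv => ?_⟩
      rcases (by simp only [Fin.ext_iff]; omega :
        (u < (k : ℕ) ∨ u = (k : ℕ) ∧ v < (j : ℕ)) ∨ (u = k ∧ v = j)) with h | ⟨rfl, rfl⟩
      · exact h3 u v h hu hv
      · by_contra hne
        obtain ⟨x, hx1, hx2, hx3, hx4⟩ := h2.1.1.exists_augment (b := v) {u | m₀ u ≠ u}
          (by simpa using hcard) (by simpa using hdeg)
          (fun a b ha hb => hmax a b (h2.2 a ha) (h2.2 b hb)) hu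
        exact h4 hu hv hne x x.2 ⟨by simpa using hx1, hx2, hx3, hx4⟩)
  obtain ⟨m, h1, h2, h3⟩ := h
  exact ⟨m, h1, h2.1, fun u v => h3 u v (Or.inl u.2)⟩

theorem recordCode_spec (hn : s 0 0 0 = n) (hm : MateIs m s) (u v : Fin n) :
    recordCode.run s 3 u v = if m u = v then 1 else s 3 u v := by
  have h := run_loop (x := 12) (b := 0)
    (c := .assign 3 (reg 12) (mateExpr (reg 12)) (.const 1)) (s := s)
    (fun k t => ∀ u v : Fin n, t 3 u v = if u < k ∧ m u = v then 1 else s 3 u v)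
    (by intro k s v h; simpa [Mem.write_of_ne] using h) (by simp) (by
      intro k t hk hx hf h u v
      rw [hn] at hk
      lift k to Fin n using hk
      have hmk := (hm.of_eq (hf 6 (by decide))) k
      simp only [run, Expr.eval, hx, hmk, Mem.write_same, h u v, Fin.val_inj]
      by_cases huk : u = k
      · subst huk
        by_cases hv : v = m u
        · simp [hv]
        · simp [hv, Ne.symm hv]
      · have : (u : ℕ) < k + 1 ↔ (u : ℕ) < k := by
          have := Fin.val_ne_of_ne huk
          omega
        simp [huk, this])
  rw [hn] at h
  simpa [recordCode] using h u v

/-- The new entries go through the scratch array 5, because each one reads old entries at partners,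
which an update in place might have overwritten. -/
theorem gramCode_spec (hn : s 0 0 0 = n) (hm : MateIs m s) (u v : Fin n) :
    gramCode.run s 4 u v = s 4 u v + s 4 u (m v) + s 4 (m u) v + s 4 (m u) (m v) := by
  rw [gramCode, run]
  set c₁ : Code := .loop 12 0 (.loop 13 0 (.assign 5 (reg 12) (reg 13)
    (.add (.add (.add (.cell 4 (reg 12) (reg 13)) (.cell 4 (reg 12) (mateExpr (reg 13))))
      (.cell 4 (mateExpr (reg 12)) (reg 13)))
      (.cell 4 (mateExpr (reg 12)) (mateExpr (reg 13)))))) with hc₁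
  have hdone : ∀ k j u v : Fin n, (u < (k : ℕ) ∨ u = (k : ℕ) ∧ v < (j : ℕ) + 1) →
      ¬ (u = k ∧ v = j) → (u < (k : ℕ) ∨ u = (k : ℕ) ∧ v < (j : ℕ)) := by
    intro k j u v huv
    simp only [Fin.ext_iff]
    omega
  have h1 := run_loop_loop (x := 12) (y := 13) (b := 0) (N := n) (c := .assign 5 (reg 12) (reg 13)
    (.add (.add (.add (.cell 4 (reg 12) (reg 13)) (.cell 4 (reg 12) (mateExpr (reg 13))))
      (.cell 4 (mateExpr (reg 12)) (reg 13)))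
      (.cell 4 (mateExpr (reg 12)) (mateExpr (reg 13))))) (s := s)
    (fun k j t => ∀ u v : Fin n, (u < k ∨ u = k ∧ v < j) →
      t 5 u v = s 4 u v + s 4 u (m v) + s 4 (m u) v + s 4 (m u) (m v)) hn (by decide) (by decide)
    (by intro k j s v h; simpa [Mem.write_of_ne] using h)
    (by intro k j s v h; simpa [Mem.write_of_ne] using h)
    (by simp)
    (by
      intro k s h u v huv
      exact h u v (by have := v.2; omega))
    (by
      intro k j t hk hj hx hy hf h u v huv
      lift k to Fin n using hk
      lift j to Fin n using hj
      have hm' : MateIs m t := hm.of_eq (hf 6 (by decide))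
      have h4 : t 4 = s 4 := hf 4 (by decide)
      simp only [run, Expr.eval, hx, hy, hm' k, hm' j, h4, Mem.write_same, Fin.val_inj]
      split_ifs with hc
      · rw [hc.1, hc.2]
      · exact h u v (hdone k j u v huv hc))
  have h2 := run_loop_loop (x := 12) (y := 13) (b := 0) (N := n)
    (c := .assign 4 (reg 12) (reg 13) (.cell 5 (reg 12) (reg 13))) (s := c₁.run s)
    (fun k j t => ∀ u v : Fin n, (u < k ∨ u = k ∧ v < j) → t 4 u v = c₁.run s 5 u v)
    (by rw [run_frame c₁ (by decide), hn]) (by decide) (by decide)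
    (by intro k j s v h; simpa [Mem.write_of_ne] using h)
    (by intro k j s v h; simpa [Mem.write_of_ne] using h)
    (by simp)
    (by
      intro k s h u v huv
      exact h u v (by have := v.2; omega))
    (by
      intro k j t hk hj hx hy hf h u v huv
      lift k to Fin n using hk
      lift j to Fin n using hj
      simp only [run, Expr.eval, hx, hy, Mem.write_same, Fin.val_inj]
      split_ifs with hc
      · rw [hc.1, hc.2, hf 5 (by decide)]
      · exact h u v (hdone k j u v huv hc))
  rw [h2 u v (Or.inl u.2)]
  exact h1 u v (Or.inl u.2)

end Algorithm

/-! ### The rounds, the running time and the output of the algorithm -/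

section Algorithm

open Code

variable {n : ℕ}

open Classical in
/-- The memory after the rounds that chose the matchings of the list `l`. -/
structure RoundState (G : SimpleGraph (Fin n)) (l : List (Fin n → Fin n)) (s : Mem) : Prop where
  size : s 0 0 0 = n
  input : ∀ u v : Fin n, s 1 u v = if G.Adj u v then 1 else 0
  output : ∀ u v : Fin n, s 3 u v = if ∃ f ∈ l, f u = v then 1 else 0
  gram : ∀ u v : Fin n, s 4 u v = gram l u v

/-- Passing to the edges not used by `l` costs each vertex at most one neighbor per matching. -/
theorem card_not_unused_le (G : SimpleGraph (Fin n)) (l : List (Fin n → Fin n)) (u : Fin n)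
    [DecidablePred fun v => ¬ (G.Adj u v ∧ ∀ f ∈ l, f u ≠ v)]
    [DecidablePred fun v => ¬ G.Adj u v] :
    Finset.card {v | ¬ (G.Adj u v ∧ ∀ f ∈ l, f u ≠ v)}
      ≤ Finset.card {v | ¬ G.Adj u v} + l.length := by
  have hsub : Finset.filter (fun v => ¬ (G.Adj u v ∧ ∀ f ∈ l, f u ≠ v)) Finset.univ ⊆
      Finset.filter (fun v => ¬ G.Adj u v) Finset.univ ∪ (l.map fun f => f u).toFinset := by
    intro v
    simp only [Finset.mem_filter, Finset.mem_univ, true_and, Finset.mem_union, List.mem_toFinset,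
      List.mem_map, not_and, not_forall, not_not]
    intro h
    by_cases hG : G.Adj u v
    · obtain ⟨f, hf, hfu⟩ := h hG
      exact Or.inr ⟨f, hf, hfu⟩
    · exact Or.inl hG
  refine (Finset.card_le_card hsub).trans ((Finset.card_union_le _ _).trans ?_)
  have := List.toFinset_card_le (l.map fun f => f u)
  rw [List.length_map] at this
  omega

open Classical in
/-- A round adds a perfect matching of unused edges that decreases the potential by a constant
factor. -/
theorem roundCode_spec {G : SimpleGraph (Fin n)} {l : List (Fin n → Fin n)} {s : Mem}
    (hst : RoundState G l s) (hl : IsMatchingList G l) (heven : Even n) (hn16 : 16 ≤ n)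
    (hdeg : ∀ u, 4 * (Finset.card {v | ¬ G.Adj u v} + l.length) ≤ n) :
    ∃ f, RoundState G (f :: l) (roundCode.run s) ∧ IsMatchingList G (f :: l) ∧
      potential (f :: l) ≤ 71 / 72 * potential l := by
  set A : Fin n → Fin n → Prop := fun u v => G.Adj u v ∧ ∀ f ∈ l, f u ≠ v with hAdef
  set w := gramWeight l with hwdef
  have hsymm : ∀ u v, A u v → A v u := by
    rintro u v ⟨h1, h2⟩
    exact ⟨h1.symm, fun f hf hfv => h2 f hf (by rw [← hfv, hl.involutive f hf v])⟩
  have hirr : ∀ u, ¬ A u u := fun u h => h.1.ne rfl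
  have hAdeg : ∀ u, 4 * (Finset.card {v | ¬ A u v}) ≤ n := fun u =>
    (Nat.mul_le_mul_left 4 (card_not_unused_le G l u)).trans (hdeg u)
  have hA : EdgesAre A s := by
    intro u v
    rw [hst.input, hst.output]
    by_cases h1 : G.Adj u v <;> by_cases h2 : ∃ f ∈ l, f u = v
    all_goals simp [hAdef, h1, h2]
    simpa using h2
  have hw : WeightsAre w s := by
    intro u v
    simp only [hst.gram]
    rfl
  have f0 : ∀ a, a ∉ resetCode.writes → resetCode.run s a = s a := fun a ha => run_frame _ ha s
  set s₁ := resetCode.run s with hs₁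
  obtain ⟨hm₁, hR₁⟩ := resetCode_spec hst.size
  have hn₁ : s₁ 0 0 0 = n := by rw [f0 0 (by decide), hst.size]
  have hA₁ : EdgesAre A s₁ := hA.of_eq (f0 1 (by decide)) (f0 3 (by decide))
  obtain ⟨m₀, hm₂, hR₂, hgr⟩ := greedyCode_spec hn₁ hA₁ (hw.of_eq (f0 4 (by decide))) hsymm hirr
    (gramWeight_self l) (gramWeight_comm l) hm₁ hR₁
  have f1 : ∀ a, a ∉ greedyCode.writes → greedyCode.run s₁ a = s₁ a := fun a ha =>
    run_frame _ ha s₁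
  set s₂ := greedyCode.run s₁ with hs₂
  have hn₂ : s₂ 0 0 0 = n := by rw [f1 0 (by decide), hn₁]
  have hA₂ : EdgesAre A s₂ := hA₁.of_eq (f1 1 (by decide)) (f1 3 (by decide))
  obtain ⟨m₁, hm₃, hext, hmax⟩ := maximalCode_spec hn₂ hA₂ hsymm hirr hm₂ hgr.matching
  have f2 : ∀ a, a ∉ maximalCode.writes → maximalCode.run s₂ a = s₂ a := fun a ha =>
    run_frame _ ha s₂
  set s₃ := maximalCode.run s₂ with hs₃
  have hn₃ : s₃ 0 0 0 = n := by rw [f2 0 (by decide), hn₂]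
  have hA₃ : EdgesAre A s₃ := hA₂.of_eq (f2 1 (by decide)) (f2 3 (by decide))
  have hcard : 8 * (Finset.card {u | m₀ u ≠ u}) ≤ n := by
    have := hgr.card_le
    omega
  obtain ⟨m, hm₄, ⟨hpm, hagree⟩, huniq⟩ := augmentCode_spec hn₃ hA₃ hsymm hAdeg hgr.matching
    (hR₂.of_eq (f2 7 (by decide))) hcard hm₃ hext hmax
  have f3 : ∀ a, a ∉ augmentCode.writes → augmentCode.run s₃ a = s₃ a := fun a ha =>
    run_frame _ ha s₃
  set s₄ := augmentCode.run s₃ with hs₄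
  have hn₄ : s₄ 0 0 0 = n := by rw [f3 0 (by decide), hn₃]
  have hrec := recordCode_spec hn₄ hm₄
  have f4 : ∀ a, a ∉ recordCode.writes → recordCode.run s₄ a = s₄ a := fun a ha =>
    run_frame _ ha s₄
  set s₅ := recordCode.run s₄ with hs₅
  have hn₅ : s₅ 0 0 0 = n := by rw [f4 0 (by decide), hn₄]
  have hgram := gramCode_spec hn₅ (hm₄.of_eq (f4 6 (by decide)))
  have f5 : ∀ a, a ∉ gramCode.writes → gramCode.run s₅ a = s₅ a := fun a ha => run_frame _ ha s₅
  have hrun : roundCode.run s = gramCode.run s₅ := rfl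
  have h4 : s₅ 4 = s 4 := by
    rw [f4 4 (by decide), f3 4 (by decide), f2 4 (by decide), f1 4 (by decide), f0 4 (by decide)]
  have h3 : s₄ 3 = s 3 := by
    rw [f3 3 (by decide), f2 3 (by decide), f1 3 (by decide), f0 3 (by decide)]
  -- At most one vertex is free, and by parity then none is.
  have hfree : ∀ u, m u ≠ u :=
    ne_of_fixed_unique hpm.1 (by simpa using heven) huniq
  have hmA : ∀ u, A u (m u) := fun u => hpm.2 u (hfree u)
  refine ⟨m, ⟨?_, ?_, ?_, ?_⟩, ⟨?_, ?_, ?_⟩, ?_⟩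
  · rw [hrun, f5 0 (by decide), hn₅]
  · intro u v
    rw [hrun, f5 1 (by decide), f4 1 (by decide), f3 1 (by decide), f2 1 (by decide),
      f1 1 (by decide), f0 1 (by decide), hst.input]
  · intro u v
    rw [hrun, f5 3 (by decide), hrec, h3, hst.output]
    by_cases hu : m u = v <;> simp [hu]
  · intro u v
    rw [hrun, hgram, h4]
    simp only [hst.gram]
    rfl
  · simp only [List.mem_cons, forall_eq_or_imp]
    exact ⟨hpm.1, hl.involutive⟩
  · simp only [List.mem_cons, forall_eq_or_imp]
    exact ⟨fun u => (hmA u).1, hl.adj⟩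
  · exact List.pairwise_cons.2 ⟨fun g hg u h => (hmA u).2 g hg h.symm, hl.pairwise⟩
  · have hpow : (0 : ℝ) < 4 ^ l.length := by positivity
    -- The greedy edges survive in the perfect matching, and the other edges have nonnegative
    -- weight.
    have hmono : ∑ x, w x (m₀ x) ≤ ∑ x, w x (m x) := by
      refine Finset.sum_le_sum fun x _ => ?_
      by_cases hx : m₀ x = x
      · rw [hx, hwdef, gramWeight_self]
        exact Nat.zero_le _
      · rw [hagree x hx]
    have hgreedy := hgr.sum_weight_le (by rw [Fintype.card_fin]; omega)
    rw [Fintype.card_fin] at hgreedy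
    have h1 := hgreedy.trans (Nat.mul_le_mul_left (18 * n) hmono)
    have h2 : (4 : ℝ) ^ l.length * ∑ u, ∑ v, (if A u v then walkDist l u v else 0)
        ≤ 18 * n * (4 ^ l.length * ∑ x, walkDist l x (m x)) := by
      have h1' : ((∑ u, ∑ v, if A u v then w u v else 0 : ℕ) : ℝ)
          ≤ ((18 * n * ∑ x, w x (m x) : ℕ) : ℝ) := Nat.cast_le.2 h1
      push_cast at h1'
      simp only [hwdef, cast_gramWeight] at h1'
      simpa only [Finset.mul_sum, mul_ite, mul_zero] using h1'
    have h3 := potential_le_sum_walkDist hl.involutive A hsymm (by simpa using hAdeg)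
    rw [Fintype.card_fin] at h3
    have hn0 : (0 : ℝ) < n := by exact_mod_cast (by omega : 0 < n)
    -- With the quarter from `potential_cons`, the factor 18 yields the decrease by 1/72.
    have h5 : potential l ≤ 18 * ∑ x, walkDist l x (m x) := by
      have h6 : (4 : ℝ) ^ l.length * n * potential l
          ≤ 4 ^ l.length * n * (18 * ∑ x, walkDist l x (m x)) := by
        calc (4 : ℝ) ^ l.length * n * potential l = 4 ^ l.length * (n * potential l) := by ring
          _ ≤ 4 ^ l.length * ∑ u, ∑ v, (if A u v then walkDist l u v else 0) :=
            mul_le_mul_of_nonneg_left h3 hpow.le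
          _ ≤ _ := h2
          _ = _ := by ring
      exact le_of_mul_le_mul_left h6 (mul_pos hpow hn0)
    rw [potential_cons hpm.1]
    linarith

theorem prepareCode_size (s : Mem) : prepareCode.run s 0 = s 0 := run_frame _ (by decide) s

/-- Register 9 runs through the powers of 2 until it reaches n, and register 8 gains 216 at each
doubling. Since n < 2ⁿ, the n passes of the loop are enough. -/
theorem prepareCode_rounds {s : Mem} (hn : s 0 0 0 = n) (h8 : s 8 0 0 = 0) :
    prepareCode.run s 8 0 0 = 216 * Nat.clog 2 n := by
  have h := run_loop (x := 11) (b := 0)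
    (c := .ite (.sub (reg 0) (reg 9)) (.seq (setReg 9 (.add (reg 9) (reg 9)))
      (setReg 8 (.add (reg 8) (.const 216)))) .skip) (s := (setReg 9 (.const 1)).run s)
    (fun k s => s 9 0 0 = 2 ^ min k (Nat.clog 2 n) ∧ s 8 0 0 = 216 * min k (Nat.clog 2 n))
    (by intro k s v h; simpa [Mem.write_of_ne] using h)
    (by simp [run, Expr.eval, Mem.write_of_ne, h8])
    (by
      rintro k t hk hx hf ⟨h1, h2⟩
      have h0 : t 0 0 0 = n := by
        rw [hf 0 (by decide)]
        simpa [run, Mem.write_of_ne] using hn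
      have hlt : 2 ^ min k (Nat.clog 2 n) < n ↔ k < Nat.clog 2 n := by
        rw [← Nat.lt_clog_iff_pow_lt (by norm_num)]
        omega
      by_cases hc : k < Nat.clog 2 n
      · rw [run_ite_of_ne (by
          simp only [Expr.eval, h0, h1]
          exact Nat.sub_ne_zero_of_lt (hlt.2 hc)),
          show min (k + 1) (Nat.clog 2 n) = min k (Nat.clog 2 n) + 1 by omega]
        simp only [run, Expr.eval, Mem.write_of_ne, Mem.write_self, ne_eq, Nat.reduceEqDiff,
          not_false_eq_true, h1, h2]
        exact ⟨by ring, by ring⟩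
      · rw [run_ite_of_not_ne (by
          simp only [Expr.eval, h0, h1, ne_eq, not_not]
          exact Nat.sub_eq_zero_of_le (not_lt.1 (hlt.not.2 hc))),
          show min (k + 1) (Nat.clog 2 n) = min k (Nat.clog 2 n) by omega]
        exact ⟨h1, h2⟩)
  have h0 : (setReg 9 (.const 1)).run s 0 0 0 = n := by simpa [run, Mem.write_of_ne] using hn
  rw [h0, min_eq_right (Nat.clog_le_of_le_pow (Nat.lt_two_pow_self).le)] at h
  have hrun : prepareCode.run s = unitCode.run (countCode.run ((setReg 9 (.const 1)).run s)) := rfl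
  rw [hrun, run_frame unitCode (by decide)]
  exact h.2

theorem prepareCode_gram {s : Mem} (hn : s 0 0 0 = n) (h4 : ∀ u v, s 4 u v = 0) (u v : Fin n) :
    prepareCode.run s 4 u v = gram [] u v := by
  set t := countCode.run ((setReg 9 (.const 1)).run s) with ht
  have hrun : prepareCode.run s = unitCode.run t := rfl
  have ht0 : t 0 = s 0 := (run_frame _ (by decide) _).trans (run_frame _ (by decide) _)
  have ht4 : t 4 = s 4 := (run_frame _ (by decide) _).trans (run_frame _ (by decide) _)
  have h := run_loop (x := 12) (b := 0) (c := .assign 4 (reg 12) (reg 12) (.const 1)) (s := t)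
    (fun k s => ∀ u v : ℕ, s 4 u v = if u < k ∧ u = v then 1 else 0)
    (by intro k s v h; simpa [Mem.write_of_ne] using h) (by simp [ht4, h4])
    (by
      intro k s' hk hx hf h u v
      simp only [run, Expr.eval, hx, Mem.write_same, h u v]
      grind)
  rw [ht0, hn] at h
  rw [hrun, unitCode, h u v]
  simp [gram, Fin.ext_iff]

open Classical in
theorem roundsCode_spec {G : SimpleGraph (Fin n)} {s : Mem} (hst : RoundState G [] s)
    (heven : Even n) (hn16 : 16 ≤ n)
    (hdeg : ∀ u, 4 * (Finset.card {v | ¬ G.Adj u v} + s 8 0 0) ≤ n) :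
    ∃ l, l.length = s 8 0 0 ∧ RoundState G l (roundsCode.run s) ∧ IsMatchingList G l ∧
      potential l ≤ (71 / 72) ^ l.length * n := by
  refine run_loop (x := 10) (b := 8) (c := roundCode) (s := s)
    (fun k s => ∃ l : List (Fin n → Fin n), l.length = k ∧ RoundState G l s ∧
      IsMatchingList G l ∧ potential l ≤ (71 / 72) ^ l.length * n) ?_ ?_ ?_
  · rintro k s v ⟨l, h1, h2, h3⟩
    refine ⟨l, h1, ⟨?_, ?_, ?_, ?_⟩, h3⟩
    · simpa [Mem.write_of_ne] using h2.size
    · simpa [Mem.write_of_ne] using h2.input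
    · simpa [Mem.write_of_ne] using h2.output
    · simpa [Mem.write_of_ne] using h2.gram
  · refine ⟨[], rfl, hst, ⟨by simp, by simp, List.Pairwise.nil⟩, ?_⟩
    simpa using potential_nil_le (V := Fin n)
  · rintro k t hk _ _ ⟨l, h1, h2, h3, h4⟩
    obtain ⟨f, g1, g2, g3⟩ := roundCode_spec h2 h3 heven hn16 (fun u => by
      have := hdeg u
      omega)
    refine ⟨f :: l, by rw [List.length_cons, h1], g1, g2, g3.trans ?_⟩
    rw [List.length_cons, pow_succ]
    linarith

/-- The whole algorithm. -/
def algorithm : Prog := .seq prepareCode.toProg roundsCode.toProg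

/-- The running time of the algorithm. -/
noncomputable def runningTime : Polynomial ℕ :=
  prepareCode.time + roundsCode.time.comp (Polynomial.C 216 * Polynomial.X)

/-- The two halves are timed separately because the first writes register 8, the number of rounds,
and the second uses it as a loop length. That number is at most 216 n. -/
theorem algorithm_exec {m : ℕ} (G : SimpleGraph (Fin n)) (r : Fin m → Bool) :
    ∃ t, Exec algorithm (initMem G r) (roundsCode.run (prepareCode.run (initMem G r))) t ∧
      t ≤ runningTime.eval n := by
  have h0 : initMem G r 0 0 0 = n := by simp [initMem]
  have h8 : initMem G r 8 0 0 = 0 := by simp [initMem]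
  obtain ⟨t, ht, htime⟩ := prepareCode.exec (by simp +decide [prepareCode, countCode, unitCode, WellFormed])
    (initMem G r)
  obtain ⟨t', ht', htime'⟩ := roundsCode.exec (by
    simp +decide [roundsCode, roundCode, resetCode, greedyCode, greedyStepCode, searchCode,
      compareCode, maximalCode, linkCode, augmentCode, augmentStepCode, recordCode, gramCode,
      WellFormed]) (prepareCode.run (initMem G r))
  refine ⟨t + t', .seq ht ht', ?_⟩
  rw [runningTime, Polynomial.eval_add, Polynomial.eval_comp, Polynomial.eval_mul,
    Polynomial.eval_C, Polynomial.eval_X]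
  refine add_le_add (htime n fun b hb => ?_) (htime' _ fun b hb => ?_)
  · obtain rfl : b = 0 := by
      revert b
      decide
    exact ⟨by decide, h0.le⟩
  · obtain rfl | rfl : b = 0 ∨ b = 8 := by
      revert b
      decide
    · refine ⟨by decide, ?_⟩
      rw [prepareCode_size, h0]
      omega
    · refine ⟨by decide, ?_⟩
      rw [prepareCode_rounds h0 h8]
      exact Nat.mul_le_mul_left _ (Nat.clog_le_of_le_pow (Nat.lt_two_pow_self).le)

theorem runsInTime_algorithm : RunsInTime algorithm runningTime := by
  intro n G r
  obtain ⟨t, ht, htime⟩ := algorithm_exec G r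
  exact ⟨_, t, ht, htime⟩

open Classical in
/-- On a dense graph, the algorithm outputs the union of disjoint perfect matchings that mix. -/
theorem algorithm_spec {m : ℕ} (G : SimpleGraph (Fin n)) (r : Fin m → Bool) (heven : Even n)
    (hn16 : 16 ≤ n)
    (hdeg : ∀ u, 4 * (Finset.card {v | ¬ G.Adj u v} + 216 * Nat.clog 2 n) ≤ n) :
    ∃ (l : List (Fin n → Fin n)) (h : IsMatchingList G l), l.length = 216 * Nat.clog 2 n ∧
      Outputs algorithm G r h.union ∧ potential l ≤ 1 / (n : ℝ) ^ 2 := by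
  have h0 : initMem G r 0 0 0 = n := by simp [initMem]
  have h8 : initMem G r 8 0 0 = 0 := by simp [initMem]
  have hR := prepareCode_rounds h0 h8
  have hst : RoundState G [] (prepareCode.run (initMem G r)) := by
    refine ⟨by rw [prepareCode_size, h0], fun u v => ?_, fun u v => ?_,
      prepareCode_gram h0 (by simp [initMem])⟩
    · rw [run_frame _ (by decide)]
      simp [initMem]
    · rw [run_frame _ (by decide)]
      simp [initMem]
  obtain ⟨l, h1, h2, h3, h4⟩ := roundsCode_spec hst heven hn16 (by rwa [hR])
  rw [hR] at h1
  refine ⟨l, h3, h1, ?_, h4.trans ?_⟩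
  · obtain ⟨t, ht, -⟩ := algorithm_exec G r
    exact ⟨_, t, ht, fun u v => (h2.output u v).trans (if_congr Iff.rfl rfl rfl)⟩
  · have hn0 : (0 : ℝ) < n := by exact_mod_cast (by omega : 0 < n)
    have hclog : (n : ℝ) ≤ 2 ^ Nat.clog 2 n := by
      exact_mod_cast Nat.le_pow_clog (by norm_num) n
    -- The constant 216 makes (71/72)²¹⁶ ≤ 1/8, so the decay is at most n⁻³ against an initial
    -- potential of at most n.
    have hp : (71 / 72 : ℝ) ^ l.length ≤ (1 / 2 ^ Nat.clog 2 n) ^ 3 := by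
      rw [h1, pow_mul]
      refine (pow_le_pow_left₀ (by positivity)
        (show ((71 / 72 : ℝ)) ^ 216 ≤ (1 / 2) ^ 3 by norm_num) _).trans (le_of_eq ?_)
      rw [← pow_mul, mul_comm 3, pow_mul, one_div_pow]
    have hq : (1 / 2 ^ Nat.clog 2 n : ℝ) ^ 3 ≤ (1 / n) ^ 3 :=
      pow_le_pow_left₀ (by positivity) (one_div_le_one_div_of_le hn0 hclog) 3
    calc (71 / 72 : ℝ) ^ l.length * n ≤ (1 / n) ^ 3 * n :=
          mul_le_mul_of_nonneg_right (hp.trans hq) hn0.le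
      _ = 1 / (n : ℝ) ^ 2 := by field_simp

end Algorithm

/-! ### Dense graphs -/

/-- The slack δn pays for the at most `t` edges at each vertex used by earlier rounds. -/
theorem card_not_adj_add_le {V : Type*} [Fintype V] (G : SimpleGraph V) [DecidableRel G.Adj]
    {δ : ℝ} {t : ℕ} (hG : (3 / 4 + δ) * (Fintype.card V : ℝ) ≤ (G.minDegree : ℝ))
    (ht : (t : ℝ) ≤ δ * Fintype.card V) (u : V) :
    4 * (Finset.card {v | ¬ G.Adj u v} + t) ≤ Fintype.card V := by
  have h1 : Finset.card {v | G.Adj u v} = G.degree u := by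
    rw [← SimpleGraph.card_neighborFinset_eq_degree]
    congr 1
    ext v
    simp
  have h2 := Finset.card_filter_add_card_filter_not (s := (Finset.univ : Finset V))
    (fun v => G.Adj u v)
  rw [h1, Finset.card_univ] at h2
  have h3 : (G.minDegree : ℝ) ≤ G.degree u := by exact_mod_cast G.minDegree_le_degree u
  have h4 : (G.degree u : ℝ) + (Finset.card {v | ¬ G.Adj u v} : ℕ) = Fintype.card V := by
    exact_mod_cast h2
  have h5 : (4 * (Finset.card {v | ¬ G.Adj u v} + t) : ℝ) ≤ Fintype.card V := by linarith
  exact_mod_cast h5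

/-- ⌈log₂ n⌉ ≤ log₂ n + 1 ≤ 2 log₂ n, and 2 / ln 2 < 3. -/
theorem cast_clog_le {n : ℕ} (hn : 2 ≤ n) : (Nat.clog 2 n : ℝ) ≤ 3 * Real.log n := by
  have h1 : 2 ^ (Nat.clog 2 n - 1) < n := Nat.pow_pred_clog_lt_self (by norm_num) (by omega)
  have hpos : 0 < Nat.clog 2 n := Nat.clog_pos (by norm_num) (by omega)
  have h2 : ((Nat.clog 2 n - 1 : ℕ) : ℝ) * Real.log 2 ≤ Real.log n := by
    rw [← Real.log_pow]
    refine Real.log_le_log (by positivity) ?_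
    exact_mod_cast h1.le
  have h3 : Real.log 2 ≤ Real.log n := Real.log_le_log (by norm_num) (by exact_mod_cast hn)
  have h4 := Real.log_two_gt_d9
  rw [Nat.cast_sub hpos, Nat.cast_one] at h2
  have h5 : (1 : ℝ) ≤ Nat.clog 2 n := by exact_mod_cast hpos
  nlinarith

theorem exists_rounds_le {δ : ℝ} (hδ : 0 < δ) :
    ∃ n₀ : ℕ, 16 ≤ n₀ ∧ ∀ n, n₀ ≤ n → ((216 * Nat.clog 2 n : ℕ) : ℝ) ≤ δ * n := by
  have h := (Real.isLittleO_log_id_atTop.comp_tendsto tendsto_natCast_atTop_atTop).def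
    (show 0 < δ / 648 by positivity)
  obtain ⟨N, hN⟩ := Filter.eventually_atTop.1 h
  refine ⟨max N 16, le_max_right _ _, fun n hn => ?_⟩
  have h1 := hN n (le_of_max_le_left hn)
  have h2 := cast_clog_le (n := n) (by have := le_of_max_le_right hn; omega)
  simp only [Function.comp_apply, id_eq, Real.norm_eq_abs, Nat.abs_cast] at h1
  have h3 := le_abs_self (Real.log n)
  push_cast
  linarith

open Classical in
theorem exists_isRegularExpanderIn {n : ℕ} (G : SimpleGraph (Fin n)) {m : ℕ} (r : Fin m → Bool)
    (heven : Even n) (hn16 : 16 ≤ n)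
    (hdeg : ∀ u, 4 * (Finset.card {v | ¬ G.Adj u v} + 216 * Nat.clog 2 n) ≤ n) :
    ∃ H : SimpleGraph (Fin n), Outputs algorithm G r H ∧
      IsRegularExpanderIn G H (216 * Nat.clog 2 n) := by
  obtain ⟨l, h, hlen, hout, hpot⟩ := algorithm_spec G r heven hn16 hdeg
  refine ⟨h.union, hout, hlen ▸ h.isRegularExpanderIn (by rw [Fintype.card_fin]; omega) ?_⟩
  exact card_lt_sum_crossing h.involutive (by rwa [Fintype.card_fin])
    (by rwa [Fintype.card_fin])

open Classical in
-- The program works on `Fin n`; its matchings for the relabelled graph are conjugated back. Only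
-- existence matters here, so it gets no random bits.
theorem exists_isRegularExpanderIn_of_fintype {V : Type*} [Fintype V] (G : SimpleGraph V)
    (heven : Even (Fintype.card V)) (hn16 : 16 ≤ Fintype.card V)
    (hdeg : ∀ u, 4 * (Finset.card {v | ¬ G.Adj u v} + 216 * Nat.clog 2 (Fintype.card V))
      ≤ Fintype.card V) :
    ∃ H : SimpleGraph V, IsRegularExpanderIn G H (216 * Nat.clog 2 (Fintype.card V)) := by
  let e := Fintype.equivFin V
  have hdeg' : ∀ u, 4 * (Finset.card {v | ¬ (G.comap e.symm).Adj u v}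
      + 216 * Nat.clog 2 (Fintype.card V)) ≤ Fintype.card V := by
    intro u
    have hcard : Finset.card {v | ¬ (G.comap e.symm).Adj u v}
        = Finset.card {v | ¬ G.Adj (e.symm u) v} :=
      Finset.card_equiv e.symm (by simp)
    rw [hcard]
    exact hdeg (e.symm u)
  obtain ⟨l, h, hlen, -, hpot⟩ := algorithm_spec (G.comap e.symm) (m := 0) Fin.elim0 heven hn16
    hdeg'
  refine ⟨(h.conj e).union, ?_⟩
  have hreg := (h.conj e).isRegularExpanderIn (by omega) fun S hS hS2 => ?_
  · rwa [List.length_map, hlen] at hreg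
  · have := card_lt_sum_crossing h.involutive (by rwa [Fintype.card_fin])
      (by rwa [Fintype.card_fin]) (S.map e.toEmbedding) (by rwa [Finset.card_map])
      (by rwa [Finset.card_map, Fintype.card_fin])
    simpa only [Finset.card_map, List.map_map, Function.comp_def, crossing_conj] using this

theorem coinProb_univ {m : ℕ} : coinProb (Set.univ : Set (Fin m → Bool)) = 1 := by
  simp [coinProb, Set.ncard_univ]

end SparseExpander

/-! ### The two halves of the theorem -/

theorem mainTheorem7 :
    (∃ C : ℝ, ∀ δ : ℝ, 0 < δ → ∃ n₀ : ℕ,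
      ∀ (V : Type*) [Fintype V] (G : SimpleGraph V) [DecidableRel G.Adj],
        n₀ ≤ Fintype.card V → Even (Fintype.card V) →
        (3 / 4 + δ) * (Fintype.card V : ℝ) ≤ (G.minDegree : ℝ) →
        ∃ (H : SimpleGraph V) (d : ℕ),
          (d : ℝ) ≤ C * Real.log (Fintype.card V) ∧
          SparseExpander.IsRegularExpanderIn G H d) ∧
    (∃ (A : SparseExpander.Prog) (p : Polynomial ℕ) (C : ℝ),
      SparseExpander.RunsInTime A p ∧
      ∀ δ : ℝ, 0 < δ → ∃ n₀ : ℕ,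
        ∀ (n : ℕ) (G : SimpleGraph (Fin n)) [DecidableRel G.Adj],
          n₀ ≤ n → Even n →
          (3 / 4 + δ) * (n : ℝ) ≤ (G.minDegree : ℝ) →
          1 - 1 / (n : ℝ) ≤ SparseExpander.coinProb {r : Fin (p.eval n) → Bool |
            ∃ (H' : SimpleGraph (Fin n)) (d' : ℕ),
              SparseExpander.Outputs A G r H' ∧
              (d' : ℝ) ≤ C * Real.log n ^ 2 ∧
              SparseExpander.IsRegularExpanderIn G H' d'}) := by
  have hrounds : ∀ n : ℕ, 16 ≤ n →
      ((216 * Nat.clog 2 n : ℕ) : ℝ) ≤ 648 * Real.log n := by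
    intro n hn
    have := SparseExpander.cast_clog_le (n := n) (by omega)
    push_cast
    linarith
  refine ⟨⟨648, fun δ hδ => ?_⟩, SparseExpander.algorithm, SparseExpander.runningTime, 648,
    SparseExpander.runsInTime_algorithm, fun δ hδ => ?_⟩
  · obtain ⟨n₀, h16, hn₀⟩ := SparseExpander.exists_rounds_le hδ
    refine ⟨n₀, fun V _ G _ hn heven hG => ?_⟩
    obtain ⟨H, hH⟩ := SparseExpander.exists_isRegularExpanderIn_of_fintype G heven (h16.trans hn)
      (fun u => by convert SparseExpander.card_not_adj_add_le G hG (hn₀ _ hn) u)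
    exact ⟨H, _, hrounds _ (h16.trans hn), hH⟩
  · obtain ⟨n₀, h16, hn₀⟩ := SparseExpander.exists_rounds_le hδ
    refine ⟨n₀, fun n G _ hn heven hG => ?_⟩
    have hdeg := SparseExpander.card_not_adj_add_le G (δ := δ) (t := 216 * Nat.clog 2 n)
      (by rwa [Fintype.card_fin]) (by rw [Fintype.card_fin]; exact hn₀ n hn)
    rw [Fintype.card_fin] at hdeg
    -- Since log n ≥ 1, the bound 648 log n is at most 648 log² n.
    have hlog : 1 ≤ Real.log n := by
      rw [Real.le_log_iff_exp_le (by exact_mod_cast (by omega : 0 < n))]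
      have h3 : (16 : ℝ) ≤ n := by exact_mod_cast h16.trans hn
      linarith [Real.exp_one_lt_d9]
    -- Every string of random bits is good, so the probability is 1.
    rw [Set.eq_univ_of_forall (s := {r | _}) fun r => ?_, SparseExpander.coinProb_univ]
    · have : (0 : ℝ) ≤ 1 / n := by positivity
      linarith
    · obtain ⟨H, hout, hH⟩ := SparseExpander.exists_isRegularExpanderIn G r heven (h16.trans hn)
        (fun u => by convert hdeg u)
      refine ⟨H, _, hout, (hrounds n (h16.trans hn)).trans ?_, hH⟩
      nlinarith
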